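/- Let $W\subset\mathbb{C}$ be open and let $r=(x^1,\dots,x^4):W\to\mathbb{R}^4$ be a smooth immersion for which $z\in W$ is a conformal parameter, i.e. $\sum_{k=1}^4 (x^k_z)^2=0$, where $\partial=\partial_z$ and $\bar\partial=\partial_{\bar z}$ are the Wirtinger derivatives. All functions below are smooth. The Gauss map $G:W\to\mathbb{C}P^3$, $G=(x^1_z:\dots:x^4_z)$, takes values in the quadric $\{y_1^2+y_2^2+y_3^2+y_4^2=0\}$, which is identified with $\mathbb{C}P^1\times\mathbb{C}P^1$ by the Segre map sending $\big((a_1:a_2),(b_1:b_2)\big)$ to $$\left(\tfrac i2(a_2b_2+a_1b_1):\tfrac12(a_2b_2-a_1b_1):\tfrac12(a_2b_1+a_1b_2):\tfrac i2(a_2b_1-a_1b_2)\right).$$ Let $G_\varphi,G_\psi:W\to\mathbb{C}P^1$ be the components of $G$: $G$ is the image of $(G_\varphi,G_\psi)$, with $G_\varphi$ in the place of $(a_1:a_2)$ and $G_\psi$ in the place of $(b_1:b_2)$. A nowhere vanishing $\psi=(\psi_1,\psi_2):W\to\mathbb{C}^2$ represents $G_\psi$ if $G_\psi=(\psi_1:\bar\psi_2)$,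 and similarly a nowhere vanishing $\varphi=(\varphi_1,\varphi_2)$ represents $G_\varphi$ if $G_\varphi=(\varphi_1:\bar\varphi_2)$. For $U:W\to\mathbb{C}$ put $$\mathcal{D}=\begin{pmatrix}U&\partial\\-\bar\partial&\bar U\end{pmatrix},\qquad \mathcal{D}^\vee=\begin{pmatrix}\bar U&\partial\\-\bar\partial&U\end{pmatrix}.$$ A triple $(\psi,\varphi,U)$ is called a Dirac lift of $G$ if $\psi$ represents $G_\psi$, $\varphi$ represents $G_\varphi$, $\mathcal{D}\psi=0$, $\mathcal{D}^\vee\varphi=0$, and $$x^1_z=\tfrac i2(\bar\varphi_2\bar\psi_2+\varphi_1\psi_1),\quad x^2_z=\tfrac12(\bar\varphi_2\bar\psi_2-\varphi_1\psi_1),\quad x^3_z=\tfrac12(\bar\varphi_2\psi_1+\varphi_1\bar\psi_2),\quad x^4_z=\tfrac i2(\bar\varphi_2\psi_1-\varphi_1\bar\psi_2).\qquad(\ast)$$ **1.** Suppose that $G_\psi=(e^{i\theta}\cos\eta:\sin\eta)$ for smooth real functions $\theta,\eta$ on $W$, and for $g:W\to\mathbb{C}$ put $\psi_g=(e^{g+i\theta}\cos\eta,\;e^{\bar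 g}\sin\eta)$ and $U_g=-e^{\bar g-g-i\theta}(i\theta_z\sin\eta\cos\eta+\eta_z)$. (a) There is a $g$ on $W$ with $g_{\bar z}=-i\theta_{\bar z}\cos^2\eta$; for it, $\psi_g$ represents $G_\psi$, and $\mathcal{D}\psi_g=0$ with the smooth potential $U_g$. (b) For any $g$ and $U$, $\mathcal{D}\psi_g=0$ holds with potential $U$ if and only if $g_{\bar z}=-i\theta_{\bar z}\cos^2\eta$ and $U=U_g$. (c) If $g$ solves $g_{\bar z}=-i\theta_{\bar z}\cos^2\eta$, then $g'$ is a solution if and only if $h=g'-g$ is holomorphic; and $U_{g+h}=e^{\bar h-h}U_g$. (d) Any two Dirac lifts $(\psi_g,\varphi,U)$ and $(\psi_{g'},\varphi',U')$ are related as in $(\ast\ast)$ below by some holomorphic $h$ on $W$. **2.** If $\psi$ represents $G_\psi$ and $\mathcal{D}\psi=0$ with a potential $U$, then there is exactly one $\varphi$ satisfying $(\ast)$; it is smooth, represents $G_\varphi$ and satisfies $\mathcal{D}^\vee\varphi=0$ with the same $U$, so $(\psi,\varphi,U)$ is a Dirac lift. **3.** If $(\psi,\varphi,U)$ is a Dirac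 lift and $h$ is holomorphic on $W$, then so is $(\psi',\varphi',U')$ given by $$\psi'=(e^h\psi_1,e^{\bar h}\psi_2),\qquad\varphi'=(e^{-h}\varphi_1,e^{-\bar h}\varphi_2),\qquad U'=e^{\bar h-h}U.\qquad(\ast\ast)$$ If $W$ is simply connected (in particular, connected), then any two Dirac lifts of $G$ are related by $(\ast\ast)$ for some holomorphic $h$ on $W$. -/

import Mathlib

open scoped ContDiff ComplexConjugate

noncomputable section

namespace SurfaceR4

/-! Wirtinger derivatives of a complex valued function of `z = x + i y`. -/

/-- `∂f/∂z = (f_x - i f_y) / 2`. -/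
def dz (f : ℂ → ℂ) (z : ℂ) : ℂ :=
  (1 / 2 : ℂ) * (fderiv ℝ f z 1 - Complex.I * fderiv ℝ f z Complex.I)

/-- `∂f/∂z̄ = (f_x + i f_y) / 2`. -/
def dzbar (f : ℂ → ℂ) (z : ℂ) : ℂ :=
  (1 / 2 : ℂ) * (fderiv ℝ f z 1 + Complex.I * fderiv ℝ f z Complex.I)

/-! Dirac operators. A spinor field is a function `ψ = (ψ₁, ψ₂)`, here `(ψ z 0, ψ z 1)`. -/

/-- The operator `𝒟 = ((0, ∂), (-∂̄, 0)) + ((U, 0), (0, Ū))` applied to `ψ`. -/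
def dirac (U : ℂ → ℂ) (ψ : ℂ → Fin 2 → ℂ) (z : ℂ) : Fin 2 → ℂ :=
  ![dz (fun w => ψ w 1) z + U z * ψ z 0,
    -dzbar (fun w => ψ w 0) z + conj (U z) * ψ z 1]

/-- The operator `𝒟^∨ = ((0, ∂), (-∂̄, 0)) + ((Ū, 0), (0, U))` applied to `φ`. -/
def diracDual (U : ℂ → ℂ) (φ : ℂ → Fin 2 → ℂ) (z : ℂ) : Fin 2 → ℂ :=
  ![dz (fun w => φ w 1) z + conj (U z) * φ z 0,
    -dzbar (fun w => φ w 0) z + U z * φ z 1]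

/-! Conformal immersions and the Gauss map. -/

/-- The vector `r_z = (x¹_z, …, x⁴_z) ∈ ℂ⁴`. -/
def rz (r : ℂ → EuclideanSpace ℝ (Fin 4)) (z : ℂ) : Fin 4 → ℂ :=
  fun k => dz (fun w => ((r w k : ℝ) : ℂ)) z

/-- `r` is a smooth immersion of `W` into `ℝ⁴` and `z` is a conformal parameter:
`⟨r_z, r_z⟩ = 0`, for the complex bilinear extension of the inner product. -/
structure IsConformalImmersionOn (r : ℂ → EuclideanSpace ℝ (Fin 4)) (W : Set ℂ) : Prop where
  isOpen : IsOpen W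
  smooth : ContDiffOn ℝ ∞ r W
  immersion : ∀ z ∈ W, Function.Injective (fderiv ℝ r z)
  conformal : ∀ z ∈ W, ∑ k, rz r z k ^ 2 = 0

theorem IsConformalImmersionOn.rz_ne_zero {r : ℂ → EuclideanSpace ℝ (Fin 4)} {W : Set ℂ}
    (hr : IsConformalImmersionOn r W) {z : ℂ} (hz : z ∈ W) : rz r z ≠ 0 := by
  intro h0
  have hd : DifferentiableAt ℝ r z :=
    (hr.smooth.contDiffAt (hr.isOpen.mem_nhds hz)).differentiableAt (by simp)
  have key : fderiv ℝ r z 1 = 0 := by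
    ext k
    have hk : HasFDerivAt (fun w => r w k)
        ((EuclideanSpace.proj k : EuclideanSpace ℝ (Fin 4) →L[ℝ] ℝ).comp (fderiv ℝ r z)) z :=
      (EuclideanSpace.proj k : EuclideanSpace ℝ (Fin 4) →L[ℝ] ℝ).hasFDerivAt.comp z
        hd.hasFDerivAt
    have hc : HasFDerivAt (fun w => ((r w k : ℝ) : ℂ)) _ z :=
      Complex.ofRealCLM.hasFDerivAt.comp z hk
    have h := congrFun h0 k
    simp only [rz, dz, hc.fderiv] at h
    have h' := congrArg Complex.re h
    simpa using h'
  exact one_ne_zero (hr.immersion z hz (key.trans (map_zero _).symm))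

/-- The Gauss map `z ↦ (x¹_z : … : x⁴_z) ∈ ℂP³`. Its values lie on the quadric
`y₁² + y₂² + y₃² + y₄² = 0`, the Grassmannian of oriented two-planes in `ℝ⁴`. -/
def gaussMap {r : ℂ → EuclideanSpace ℝ (Fin 4)} {W : Set ℂ}
    (hr : IsConformalImmersionOn r W) (z : W) : Projectivization ℂ (Fin 4 → ℂ) :=
  Projectivization.mk ℂ (rz r z) (hr.rz_ne_zero z.2)

/-! The Segre map onto the quadric. -/

/-- The Segre map in homogeneous coordinates: `y'₁ = a₂b₂`, `y'₂ = a₁b₁`, `y'₃ = a₂b₁`,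
`y'₄ = a₁b₂`, and `y₁ = i(y'₁ + y'₂)/2`, `y₂ = (y'₁ - y'₂)/2`, `y₃ = (y'₃ + y'₄)/2`,
`y₄ = i(y'₃ - y'₄)/2`. -/
def segreVec (a b : Fin 2 → ℂ) : Fin 4 → ℂ :=
  ![Complex.I / 2 * (a 1 * b 1 + a 0 * b 0),
    1 / 2 * (a 1 * b 1 - a 0 * b 0),
    1 / 2 * (a 1 * b 0 + a 0 * b 1),
    Complex.I / 2 * (a 1 * b 0 - a 0 * b 1)]

theorem segreVec_ne_zero {a b : Fin 2 → ℂ} (ha : a ≠ 0) (hb : b ≠ 0) : segreVec a b ≠ 0 := by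
  intro h
  have h0 := congrFun h 0
  have h1 := congrFun h 1
  have h2 := congrFun h 2
  have h3 := congrFun h 3
  simp [segreVec, Complex.I_ne_zero] at h0 h1 h2 h3
  have e11 : a 1 * b 1 = 0 := by linear_combination (h0 + h1) / 2
  have e00 : a 0 * b 0 = 0 := by linear_combination (h0 - h1) / 2
  have e10 : a 1 * b 0 = 0 := by linear_combination (h2 + h3) / 2
  have e01 : a 0 * b 1 = 0 := by linear_combination (h2 - h3) / 2
  apply hb
  by_cases ha0 : a 0 = 0
  · have ha1 : a 1 ≠ 0 := by
      intro ha1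
      exact ha (by ext i; fin_cases i <;> simp [ha0, ha1])
    ext i
    fin_cases i
    · simpa [ha1] using e10
    · simpa [ha1] using e11
  · ext i
    fin_cases i
    · simpa [ha0] using e00
    · simpa [ha0] using e01

/-- The Segre map `ℂP¹ × ℂP¹ → ℂP³`, a bijection onto the quadric. -/
def segre (a b : Projectivization ℂ (Fin 2 → ℂ)) : Projectivization ℂ (Fin 4 → ℂ) :=
  Projectivization.mk ℂ (segreVec a.rep b.rep) (segreVec_ne_zero a.rep_nonzero b.rep_nonzero)

theorem segre_mk (a b : Fin 2 → ℂ) (ha : a ≠ 0) (hb : b ≠ 0) :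
    segre (Projectivization.mk ℂ a ha) (Projectivization.mk ℂ b hb) =
      Projectivization.mk ℂ (segreVec a b) (segreVec_ne_zero ha hb) := by
  obtain ⟨s, hs⟩ := Projectivization.exists_smul_eq_mk_rep ℂ a ha
  obtain ⟨t, ht⟩ := Projectivization.exists_smul_eq_mk_rep ℂ b hb
  rw [segre, Projectivization.mk_eq_mk_iff']
  refine ⟨(s : ℂ) * t, ?_⟩
  rw [← hs, ← ht]
  ext i
  fin_cases i <;> simp [segreVec, Units.smul_def] <;> ring

/-- `G = (G_ψ, G_φ)`: the two maps are the components of the Gauss map of `r` under the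
Segre equivalence. -/
def AreGaussComponents {r : ℂ → EuclideanSpace ℝ (Fin 4)} {W : Set ℂ}
    (hr : IsConformalImmersionOn r W) (Gψ Gφ : W → Projectivization ℂ (Fin 2 → ℂ)) : Prop :=
  ∀ z : W, segre (Gφ z) (Gψ z) = gaussMap hr z

/-! Lifts. -/

/-- The vector `(χ₁, χ̄₂)` attached to a spinor `χ = (χ₁, χ₂)`. -/
def halfConj (χ : Fin 2 → ℂ) : Fin 2 → ℂ := ![χ 0, conj (χ 1)]

/-- The spinor field `χ` does not vanish on `W` and represents `G`: `G = (χ₁ : χ̄₂)`. -/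
def Represents {W : Set ℂ} (χ : ℂ → Fin 2 → ℂ) (G : W → Projectivization ℂ (Fin 2 → ℂ)) :
    Prop :=
  ∀ z : W, ∃ h : halfConj (χ z) ≠ 0, G z = Projectivization.mk ℂ (halfConj (χ z)) h

/-- The Weierstrass formulas for `r_z`:
`x¹_z = i(φ̄₂ψ̄₂ + φ₁ψ₁)/2`, `x²_z = (φ̄₂ψ̄₂ - φ₁ψ₁)/2`,
`x³_z = (φ̄₂ψ₁ + φ₁ψ̄₂)/2`, `x⁴_z = i(φ̄₂ψ₁ - φ₁ψ̄₂)/2`. -/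
def WeierstrassFormula (r : ℂ → EuclideanSpace ℝ (Fin 4)) (W : Set ℂ)
    (ψ φ : ℂ → Fin 2 → ℂ) : Prop :=
  ∀ z ∈ W, rz r z = segreVec (halfConj (φ z)) (halfConj (ψ z))

/-- `(ψ, φ)` is a smooth lift of `(G_ψ, G_φ)` to nonvanishing spinors which gives `r_z` by the
Weierstrass formulas and satisfies the Dirac equations with the potential `U`. -/
structure IsDiracLift (r : ℂ → EuclideanSpace ℝ (Fin 4)) {W : Set ℂ}
    (Gψ Gφ : W → Projectivization ℂ (Fin 2 → ℂ)) (ψ φ : ℂ → Fin 2 → ℂ) (U : ℂ → ℂ) :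
    Prop where
  smooth_psi : ContDiffOn ℝ ∞ ψ W
  smooth_phi : ContDiffOn ℝ ∞ φ W
  represents_psi : Represents ψ Gψ
  represents_phi : Represents φ Gφ
  weierstrass : WeierstrassFormula r W ψ φ
  dirac_psi : ∀ z ∈ W, dirac U ψ z = 0
  dirac_phi : ∀ z ∈ W, diracDual U φ z = 0

/-- The second triple is obtained from the first one on `W` by the gauge transformation
`ψ' = (e^h ψ₁, e^{h̄} ψ₂)`, `φ' = (e^{-h} φ₁, e^{-h̄} φ₂)`, `U' = e^{h̄ - h} U`. -/
def GaugeRelated (W : Set ℂ) (h : ℂ → ℂ) (ψ φ : ℂ → Fin 2 → ℂ) (U : ℂ → ℂ)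
    (ψ' φ' : ℂ → Fin 2 → ℂ) (U' : ℂ → ℂ) : Prop :=
  ∀ z ∈ W,
    ψ' z = ![Complex.exp (h z) * ψ z 0, Complex.exp (conj (h z)) * ψ z 1] ∧
    φ' z = ![Complex.exp (-h z) * φ z 0, Complex.exp (-conj (h z)) * φ z 1] ∧
    U' z = Complex.exp (conj (h z) - h z) * U z

/-! The lift in spherical coordinates. -/

/-- The vector `(e^{iθ} cos η, sin η)`. -/
def sphericalVec (θ η : ℝ) : Fin 2 → ℂ :=
  ![Complex.exp (Complex.I * θ) * Real.cos η, Real.sin η]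

theorem sphericalVec_ne_zero (θ η : ℝ) : sphericalVec θ η ≠ 0 := by
  intro h
  have h0 := congrFun h 0
  have h1 := congrFun h 1
  simp only [sphericalVec, Matrix.cons_val_zero, Matrix.cons_val_one, Pi.zero_apply,
    mul_eq_zero, Complex.exp_ne_zero, false_or, Complex.ofReal_eq_zero] at h0 h1
  have := Real.sin_sq_add_cos_sq η
  simp [h0, h1] at this

/-- The point `(e^{iθ} cos η : sin η)` of `ℂP¹`. -/
def sphericalPoint (θ η : ℝ) : Projectivization ℂ (Fin 2 → ℂ) :=
  Projectivization.mk ℂ (sphericalVec θ η) (sphericalVec_ne_zero θ η)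

/-- The spinor field `(e^{g+iθ} cos η, e^{ḡ} sin η)`. -/
def liftOf (θ η : ℂ → ℝ) (g : ℂ → ℂ) (z : ℂ) : Fin 2 → ℂ :=
  ![Complex.exp (g z + Complex.I * θ z) * Real.cos (η z),
    Complex.exp (conj (g z)) * Real.sin (η z)]

/-- The equation `g_z̄ = -i θ_z̄ cos² η` on `W`. -/
def SolvesDbar (W : Set ℂ) (θ η : ℂ → ℝ) (g : ℂ → ℂ) : Prop :=
  ∀ z ∈ W, dzbar g z =
    -Complex.I * dzbar (fun w => ((θ w : ℝ) : ℂ)) z * (Real.cos (η z) : ℂ) ^ 2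

/-- The potential `-e^{ḡ - g - iθ} (i θ_z sin η cos η + η_z)`. -/
def potentialOf (θ η : ℂ → ℝ) (g : ℂ → ℂ) (z : ℂ) : ℂ :=
  -Complex.exp (conj (g z) - g z - Complex.I * θ z) *
    (Complex.I * dz (fun w => ((θ w : ℝ) : ℂ)) z * Real.sin (η z) * Real.cos (η z) +
      dz (fun w => ((η w : ℝ) : ℂ)) z)

end SurfaceR4

end

open SurfaceR4

/-! Put `a = halfConj φ` and `b = halfConj ψ`. The Weierstrass formulas say that `r_z` is the Segre
vector of `a` and `b`, which is bilinear, and a linear change of coordinates recovers the four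
products `a i * b j`. Contracting them with the conjugate of `b` gives `a` as a smooth expression in
`r_z` and `b` (`segreVec_eq_left`), so `ψ` determines a smooth `φ`. Because `r_{z z̄}` is real, the
derivatives of these products satisfy two linear relations. Together with `𝒟ψ = 0` they form a
homogeneous system for the components of `𝒟^∨φ` with determinant `|ψ₁|² + |ψ₂|²` up to sign, hence
`𝒟^∨φ = 0`.

A gauge transformation multiplies `b` by `e^h` and `a` by `e^{-h}`, so `r_z` is unchanged.
Conversely, if two lifts have `b' = e^h b` with `h` smooth, their Dirac equations form a system of
the same type for `h_z̄` and the defect of `U'`, so both vanish (`IsDiracLift.gaugeRelated`). For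
spherical lifts `h = g' - g` exists globally. In general `b' = l b` with `l` smooth and
nonvanishing, and a logarithm of `l` is where simple connectedness enters.

The analytic part is solving `g_z̄ = f` on an arbitrary open set (`IsOpen.exists_dzbar_eq`). A
partition of unity cuts `f` into pieces `F n` supported in small discs, and the Cauchy transform
solves each piece. To make the solutions summable, the transform is twisted by a high power of a
holomorphic function, `z` or `1/(z - p)` with `p ∉ W`, which is larger on the disc than on a far
set. This yields convergence directly, without an approximation theorem of Runge type. -/

section Wirtinger

/-! ### Calculus of Wirtinger derivatives -/

theorem dz_congr {f g : ℂ → ℂ} {z : ℂ} (h : f =ᶠ[nhds z] g) : dz f z = dz g z := by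
  simp only [dz, h.fderiv_eq]

theorem dzbar_congr {f g : ℂ → ℂ} {z : ℂ} (h : f =ᶠ[nhds z] g) : dzbar f z = dzbar g z := by
  simp only [dzbar, h.fderiv_eq]

theorem dzbar_add {f g : ℂ → ℂ} {z : ℂ} (hf : DifferentiableAt ℝ f z)
    (hg : DifferentiableAt ℝ g z) : dzbar (fun w => f w + g w) z = dzbar f z + dzbar g z := by
  simp only [dzbar, fderiv_fun_add hf hg, add_apply]
  ring

theorem dzbar_sub {f g : ℂ → ℂ} {z : ℂ} (hf : DifferentiableAt ℝ f z)
    (hg : DifferentiableAt ℝ g z) : dzbar (fun w => f w - g w) z = dzbar f z - dzbar g z := by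
  simp only [dzbar, fderiv_fun_sub hf hg, sub_apply]
  ring

theorem dz_mul {f g : ℂ → ℂ} {z : ℂ} (hf : DifferentiableAt ℝ f z)
    (hg : DifferentiableAt ℝ g z) :
    dz (fun w => f w * g w) z = dz f z * g z + f z * dz g z := by
  simp only [dz, fderiv_fun_mul hf hg, add_apply, smul_apply, smul_eq_mul]
  ring

theorem dzbar_mul {f g : ℂ → ℂ} {z : ℂ} (hf : DifferentiableAt ℝ f z)
    (hg : DifferentiableAt ℝ g z) :
    dzbar (fun w => f w * g w) z = dzbar f z * g z + f z * dzbar g z := by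
  simp only [dzbar, fderiv_fun_mul hf hg, add_apply, smul_apply, smul_eq_mul]
  ring

theorem dzbar_const_mul {f : ℂ → ℂ} {z : ℂ} (c : ℂ) (hf : DifferentiableAt ℝ f z) :
    dzbar (fun w => c * f w) z = c * dzbar f z := by
  rw [dzbar_mul (differentiableAt_const c) hf]
  simp [dzbar]

theorem fderiv_conj_comp (f : ℂ → ℂ) (z v : ℂ) :
    fderiv ℝ (fun w => conj (f w)) z v = conj (fderiv ℝ f z v) := by
  have h := ContinuousLinearEquiv.comp_fderiv Complex.conjCLE (f := f) (x := z)
  have := congrArg (fun L : ℂ →L[ℝ] ℂ => L v) h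
  simpa [Function.comp_def] using this

theorem dz_conj (f : ℂ → ℂ) (z : ℂ) : dz (fun w => conj (f w)) z = conj (dzbar f z) := by
  simp only [dz, dzbar, fderiv_conj_comp, map_mul, map_add, Complex.conj_I, map_div₀, map_one,
    map_ofNat]
  ring

theorem dzbar_conj (f : ℂ → ℂ) (z : ℂ) : dzbar (fun w => conj (f w)) z = conj (dz f z) := by
  simp only [dz, dzbar, fderiv_conj_comp, map_mul, map_sub, Complex.conj_I, map_div₀, map_one,
    map_ofNat]
  ring

theorem dz_comp {F f : ℂ → ℂ} {F' z : ℂ} (hF : HasDerivAt F F' (f z))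
    (hf : DifferentiableAt ℝ f z) : dz (fun w => F (f w)) z = F' * dz f z := by
  have h := (hF.hasFDerivAt.restrictScalars ℝ).comp z hf.hasFDerivAt
  have h' : fderiv ℝ (fun w => F (f w)) z = _ := h.fderiv
  simp only [dz, h']
  simp
  ring

theorem dzbar_comp {F f : ℂ → ℂ} {F' z : ℂ} (hF : HasDerivAt F F' (f z))
    (hf : DifferentiableAt ℝ f z) : dzbar (fun w => F (f w)) z = F' * dzbar f z := by
  have h := (hF.hasFDerivAt.restrictScalars ℝ).comp z hf.hasFDerivAt
  have h' : fderiv ℝ (fun w => F (f w)) z = _ := h.fderiv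
  simp only [dzbar, h']
  simp
  ring

theorem differentiableAt_complex_iff_dzbar_eq_zero {f : ℂ → ℂ} {z : ℂ} :
    DifferentiableAt ℂ f z ↔ DifferentiableAt ℝ f z ∧ dzbar f z = 0 := by
  rw [differentiableAt_complex_iff_differentiableAt_real]
  refine and_congr_right fun _ => ?_
  simp only [dzbar, smul_eq_mul]
  constructor
  · intro h
    rw [h]
    linear_combination (1 / 2 : ℂ) * fderiv ℝ f z 1 * Complex.I_mul_I
  · intro h
    linear_combination (-2 * Complex.I) * h + fderiv ℝ f z Complex.I * Complex.I_mul_I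

theorem dzbar_eq_zero_of_differentiableOn {f : ℂ → ℂ} {W : Set ℂ} (hW : IsOpen W)
    (hf : DifferentiableOn ℂ f W) {z : ℂ} (hz : z ∈ W) : dzbar f z = 0 :=
  (differentiableAt_complex_iff_dzbar_eq_zero.1 (hf.differentiableAt (hW.mem_nhds hz))).2

theorem contDiffOn_real_of_differentiableOn {f : ℂ → ℂ} {W : Set ℂ} (hW : IsOpen W)
    (hf : DifferentiableOn ℂ f W) : ContDiffOn ℝ ∞ f W :=
  (hf.contDiffOn hW).restrict_scalars ℝ

theorem contDiffOn_fderiv_apply {f : ℂ → ℂ} {W : Set ℂ} (hW : IsOpen W)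
    (hf : ContDiffOn ℝ ∞ f W) (v : ℂ) : ContDiffOn ℝ ∞ (fun z => fderiv ℝ f z v) W :=
  (hf.fderiv_of_isOpen hW (by simp)).clm_apply contDiffOn_const

theorem contDiffOn_dz {f : ℂ → ℂ} {W : Set ℂ} (hW : IsOpen W) (hf : ContDiffOn ℝ ∞ f W) :
    ContDiffOn ℝ ∞ (dz f) W :=
  contDiffOn_const.mul ((contDiffOn_fderiv_apply hW hf 1).sub
    (contDiffOn_const.mul (contDiffOn_fderiv_apply hW hf Complex.I)))

theorem contDiffOn_dzbar {f : ℂ → ℂ} {W : Set ℂ} (hW : IsOpen W) (hf : ContDiffOn ℝ ∞ f W) :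
    ContDiffOn ℝ ∞ (dzbar f) W :=
  contDiffOn_const.mul ((contDiffOn_fderiv_apply hW hf 1).add
    (contDiffOn_const.mul (contDiffOn_fderiv_apply hW hf Complex.I)))

theorem dz_dzbar_comm {f : ℂ → ℂ} {W : Set ℂ} (hW : IsOpen W) (hf : ContDiffOn ℝ ∞ f W)
    {z : ℂ} (hz : z ∈ W) : dz (dzbar f) z = dzbar (dz f) z := by
  have hfz : ContDiffAt ℝ ∞ f z := hf.contDiffAt (hW.mem_nhds hz)
  have hd : DifferentiableAt ℝ (fderiv ℝ f) z :=
    (hfz.fderiv_right (m := 1) (by norm_cast)).differentiableAt (by simp)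
  have hv (v : ℂ) : HasFDerivAt (fun w => fderiv ℝ f w v) ((fderiv ℝ (fderiv ℝ f) z).flip v) z := by
    simpa using hd.hasFDerivAt.clm_apply (hasFDerivAt_const v z)
  have hs : fderiv ℝ (fderiv ℝ f) z 1 Complex.I = fderiv ℝ (fderiv ℝ f) z Complex.I 1 :=
    (hfz.isSymmSndFDerivAt (by simpa using WithTop.coe_le_coe.2 (le_top : (2 : ℕ∞) ≤ ⊤))).eq 1 Complex.I
  have h1 : HasFDerivAt (dz f) _ z := ((hv 1).sub ((hv Complex.I).const_mul Complex.I)).const_mul _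
  have h2 : HasFDerivAt (dzbar f) _ z :=
    ((hv 1).add ((hv Complex.I).const_mul Complex.I)).const_mul _
  rw [dz, dzbar, h1.fderiv, h2.fderiv]
  simp [hs]
  ring

/-- For real `x` the mixed derivative `x_{z z̄}` is a quarter of the Laplacian. This is the only use
made of the reality of `r`. -/
theorem conj_dzbar_dz_ofReal {x : ℂ → ℝ} {W : Set ℂ} (hW : IsOpen W) (hx : ContDiffOn ℝ ∞ x W)
    {z : ℂ} (hz : z ∈ W) :
    conj (dzbar (dz fun w => (x w : ℂ)) z) = dzbar (dz fun w => (x w : ℂ)) z := by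
  have hc : ContDiffOn ℝ ∞ (fun w => (x w : ℂ)) W := Complex.ofRealCLM.contDiff.comp_contDiffOn hx
  have h (w : ℂ) : conj (dz (fun w => (x w : ℂ)) w) = dzbar (fun w => (x w : ℂ)) w := by
    rw [← dzbar_conj]
    simp
  rw [← dz_conj, ← dz_dzbar_comm hW hc hz]
  simp only [h]

end Wirtinger

/-! ### The Cauchy transform of a compactly supported function -/

section CauchyTransform
open MeasureTheory Set Filter Topology

/-- In polar coordinates the Jacobian `r` cancels the singularity `1/r`. -/
theorem locallyIntegrable_inv : LocallyIntegrable (fun w : ℂ => w⁻¹) := by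
  rw [locallyIntegrable_iff]
  intro K hK
  obtain ⟨R, hR⟩ := hK.isBounded.subset_ball (0 : ℂ)
  refine IntegrableOn.mono_set ?_ hR
  rw [← integrable_indicator_iff measurableSet_ball]
  refine Integrable.mono' (g := fun w : ℂ => (Iio R).indicator (fun r : ℝ => r⁻¹) ‖w‖) ?_
    ((by fun_prop : Measurable fun w : ℂ => w⁻¹).indicator measurableSet_ball).aestronglyMeasurable
    (Eventually.of_forall fun w => ?_)
  · rw [integrable_fun_norm_addHaar volume (E := ℂ) (f := (Iio R).indicator (fun r : ℝ => r⁻¹))]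
    have h1 : IntegrableOn (fun _ : ℝ => (1 : ℝ)) (Ioo 0 R) := by simp
    rw [← integrable_indicator_iff measurableSet_Ioo] at h1
    refine (h1.integrableOn (s := Ioi 0)).congr_fun (fun r hr => ?_) measurableSet_Ioi
    have hr0 : r ≠ 0 := (mem_Ioi.1 hr).ne'
    by_cases hrR : r < R
    · simp [indicator, hrR, mem_Ioi.1 hr, hr0]
    · simp [indicator, hrR]
  · by_cases h : ‖w‖ < R <;> simp [indicator, h]

/-- In polar coordinates `G_z̄ = e^{it} (∂_s G + (i/s) ∂_t G) / 2`, so the integrand times the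
Jacobian is `(A + iB)/2`. Here `A` is the radial derivative, with integral `-G 0` along each ray,
and `B` is the angular derivative divided by `s`, with integral zero over each circle. -/
theorem integral_inv_mul_dzbar {G : ℂ → ℂ} (hG : ContDiff ℝ 1 G) (hc : HasCompactSupport G) :
    ∫ w, w⁻¹ * dzbar G w = -(Real.pi * G 0) := by
  set e : ℝ → ℂ := fun t => Real.cos t + Real.sin t * Complex.I with he
  have hee (t : ℝ) : e t ≠ 0 := by
    rw [he]
    simp only [Complex.ofReal_cos, Complex.ofReal_sin, ← Complex.exp_mul_I]
    exact Complex.exp_ne_zero _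
  have hnorm (p : ℝ × ℝ) : ‖(p.1 : ℂ) * e p.2‖ = |p.1| := by
    have := Complex.norm_polarCoord_symm p
    rwa [Complex.polarCoord_symm_apply] at this
  have hde (t : ℝ) : HasDerivAt e (Complex.I * e t) t := by
    have h := ((Real.hasDerivAt_cos t).ofReal_comp).add
      ((Real.hasDerivAt_sin t).ofReal_comp.mul_const Complex.I)
    refine h.congr_deriv ?_
    simp only [he]
    push_cast
    linear_combination (-Complex.sin t) * Complex.I_mul_I
  have hce : Continuous e := by fun_prop
  have hG' : Continuous (fderiv ℝ G) := hG.continuous_fderiv one_ne_zero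
  have hGd (w : ℂ) : HasFDerivAt G (fderiv ℝ G w) w :=
    (hG.differentiable one_ne_zero w).hasFDerivAt
  -- Written through `fderiv`, the quotient `B` is continuous also at radius zero.
  set A : ℝ × ℝ → ℂ := fun p => fderiv ℝ G (p.1 * e p.2) (e p.2)
  set B : ℝ × ℝ → ℂ := fun p => fderiv ℝ G (p.1 * e p.2) (Complex.I * e p.2)
  have hA : Continuous A := by fun_prop
  have hB : Continuous B := by fun_prop
  obtain ⟨R, hR0, hR⟩ : ∃ R : ℝ, 0 < R ∧ ∀ w : ℂ, R < ‖w‖ → G w = 0 ∧ fderiv ℝ G w = 0 := by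
    obtain ⟨R, hR0, hR⟩ := hc.isCompact.isBounded.exists_pos_norm_le
    refine ⟨R, hR0, fun w hw => ?_⟩
    have hw' : w ∉ tsupport G := fun h => absurd (hR w h) (not_le.2 hw)
    exact ⟨image_eq_zero_of_notMem_tsupport hw',
      image_eq_zero_of_notMem_tsupport fun h => hw' (tsupport_fderiv_subset ℝ h)⟩
  have hint {F : ℝ × ℝ → ℂ} (hF : Continuous F) (hF0 : ∀ p : ℝ × ℝ, R < |p.1| → F p = 0) :
      IntegrableOn F (Ioi (0 : ℝ) ×ˢ Ioo (-Real.pi) Real.pi) := by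
    have h1 : IntegrableOn F (Icc (0 : ℝ) R ×ˢ Icc (-Real.pi) Real.pi) :=
      hF.continuousOn.integrableOn_compact (isCompact_Icc.prod isCompact_Icc)
    refine h1.of_forall_sdiff_eq_zero (measurableSet_Ioi.prod measurableSet_Ioo) fun p hp => ?_
    obtain ⟨⟨hp1, hp2⟩, hp3⟩ := hp
    refine hF0 p ?_
    by_contra hcon
    exact hp3 ⟨⟨hp1.le, (le_abs_self _).trans (not_lt.1 hcon)⟩, Ioo_subset_Icc_self hp2⟩
  have hA0 (p : ℝ × ℝ) (hp : R < |p.1|) : A p = 0 := by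
    simp only [A, (hR _ ((hnorm p).symm ▸ hp)).2, zero_apply]
  have hB0 (p : ℝ × ℝ) (hp : R < |p.1|) : B p = 0 := by
    simp only [B, (hR _ ((hnorm p).symm ▸ hp)).2, zero_apply]
  have hAint := hint hA hA0
  have hBint := hint hB hB0
  have hAval : ∫ p in Ioi (0 : ℝ) ×ˢ Ioo (-Real.pi) Real.pi, A p = -(2 * Real.pi * G 0) := by
    have hr (t : ℝ) : ∫ s in Ioi (0 : ℝ), A (s, t) = -G 0 := by
      have hd (s : ℝ) : HasDerivAt (fun s : ℝ => G (s * e t)) (A (s, t)) s := by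
        have h := (hGd (s * e t)).comp_hasDerivAt s
          ((hasDerivAt_id s).ofReal_comp.mul_const (e t))
        simpa [Function.comp_def] using h
      have hcs (s : ℝ) (hs : R < s) : A (s, t) = 0 := hA0 (s, t) (hs.trans_le (le_abs_self s))
      have hi : IntegrableOn (fun s => A (s, t)) (Ioi 0) := by
        have h1 : IntegrableOn (fun s => A (s, t)) (Icc 0 R) :=
          (by fun_prop : Continuous fun s => A (s, t)).continuousOn.integrableOn_compact
            isCompact_Icc
        refine h1.of_forall_sdiff_eq_zero measurableSet_Ioi fun s hs => hcs s ?_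
        by_contra hcon
        exact hs.2 ⟨le_of_lt hs.1, not_lt.1 hcon⟩
      have ht : Tendsto (fun s : ℝ => G (s * e t)) atTop (𝓝 0) := by
        refine tendsto_const_nhds.congr' ?_
        filter_upwards [eventually_gt_atTop R] with s hs
        exact ((hR _ ((hnorm (s, t)).symm ▸ hs.trans_le (le_abs_self s))).1).symm
      simpa using integral_Ioi_of_hasDerivAt_of_tendsto' (a := 0) (fun s _ => hd s) hi ht
    rw [Measure.volume_eq_prod, ← Measure.prod_restrict, integral_prod_symm _
      (by rw [Measure.prod_restrict]; exact hAint)]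
    simp only [hr, setIntegral_const]
    rw [Real.volume_real_Ioo_of_le (by linarith [Real.pi_pos]), Complex.real_smul]
    push_cast
    ring
  have hBval : ∫ p in Ioi (0 : ℝ) ×ˢ Ioo (-Real.pi) Real.pi, B p = 0 := by
    rw [Measure.volume_eq_prod, setIntegral_prod _ hBint]
    refine setIntegral_eq_zero_of_forall_eq_zero fun s hs => ?_
    have hs0 : (s : ℂ) ≠ 0 := by exact_mod_cast (mem_Ioi.1 hs).ne'
    have hd (t : ℝ) : HasDerivAt (fun t : ℝ => (s : ℂ)⁻¹ * G (s * e t)) (B (s, t)) t := by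
      have h := ((hGd (s * e t)).comp_hasDerivAt t ((hde t).const_mul (s : ℂ))).const_mul (s : ℂ)⁻¹
      refine h.congr_deriv ?_
      have : (s : ℂ) * (Complex.I * e t) = s • (Complex.I * e t) := by simp
      rw [this, map_smul, Complex.real_smul, inv_mul_cancel_left₀ hs0]
    have h := intervalIntegral.integral_eq_sub_of_hasDerivAt (a := -Real.pi) (b := Real.pi)
      (fun t _ => hd t) ((by fun_prop : Continuous fun t => B (s, t)).intervalIntegrable _ _)
    rw [intervalIntegral.integral_of_le (by linarith [Real.pi_pos]),
      integral_Ioc_eq_integral_Ioo] at h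
    rw [h]
    simp [he]
  rw [← Complex.integral_comp_polarCoord_symm, polarCoord_target]
  have hcongr : ∫ p in Ioi (0 : ℝ) ×ˢ Ioo (-Real.pi) Real.pi,
      p.1 • ((Complex.polarCoord.symm p)⁻¹ * dzbar G (Complex.polarCoord.symm p)) =
      ∫ p in Ioi (0 : ℝ) ×ˢ Ioo (-Real.pi) Real.pi, (1 / 2 : ℂ) * (A p + Complex.I * B p) := by
    refine setIntegral_congr_fun (measurableSet_Ioi.prod measurableSet_Ioo) fun p hp => ?_
    have hp0 : (p.1 : ℂ) ≠ 0 := by exact_mod_cast (mem_Ioi.1 hp.1).ne'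
    have hlin (a b : ℝ) : fderiv ℝ G (p.1 * e p.2) (a + b * Complex.I) =
        a * fderiv ℝ G (p.1 * e p.2) 1 + b * fderiv ℝ G (p.1 * e p.2) Complex.I := by
      have : (a + b * Complex.I : ℂ) = a • (1 : ℂ) + b • Complex.I := by simp
      rw [this, map_add, map_smul, map_smul, Complex.real_smul, Complex.real_smul]
    have hIe : Complex.I * e p.2 = ((-Real.sin p.2 : ℝ) : ℂ) + (Real.cos p.2 : ℝ) * Complex.I := by
      simp only [he]
      push_cast
      linear_combination (Complex.sin p.2) * Complex.I_mul_I
    have hsq : (Real.sin p.2 : ℂ) ^ 2 + (Real.cos p.2 : ℂ) ^ 2 = 1 := by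
      exact_mod_cast Real.sin_sq_add_cos_sq p.2
    have hAp : A p = _ := hlin (Real.cos p.2) (Real.sin p.2)
    have hBp : B p = _ := (congrArg _ hIe).trans (hlin _ _)
    simp only [Complex.polarCoord_symm_apply]
    change p.1 • (((p.1 : ℂ) * e p.2)⁻¹ * dzbar G ((p.1 : ℂ) * e p.2)) = _
    rw [hAp, hBp, dzbar, Complex.real_smul, mul_inv, mul_assoc (_⁻¹), mul_inv_cancel_left₀ hp0,
      inv_mul_eq_iff_eq_mul₀ (hee _)]
    generalize fderiv ℝ G (p.1 * e p.2) 1 = x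
    generalize fderiv ℝ G (p.1 * e p.2) Complex.I = y
    simp only [he]
    push_cast at hsq ⊢
    generalize Complex.cos p.2 = c at *
    generalize Complex.sin p.2 = s at *
    linear_combination (-(1 / 2) * (x + Complex.I * y)) * hsq +
      (1 / 2) * (s ^ 2 * x - c * s * y) * Complex.I_mul_I
  rw [hcongr, integral_const_mul, integral_add hAint (hBint.const_mul _), integral_const_mul,
    hAval, hBval]
  ring

/-- The Cauchy transform `(1/π) ∫ g(ζ) / (z - ζ) dA(ζ)`. -/
noncomputable def cauchyTransform (g : ℂ → ℂ) (z : ℂ) : ℂ :=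
  (Real.pi : ℂ)⁻¹ * ∫ w, w⁻¹ * g (z - w)

/-- Up to the factor `1/π` the transform is the convolution of `w⁻¹` with `g`, so the derivatives
fall on `g`. -/
theorem contDiff_cauchyTransform {g : ℂ → ℂ} (hg : ContDiff ℝ ∞ g) (hc : HasCompactSupport g) :
    ContDiff ℝ ∞ (cauchyTransform g) :=
  contDiff_const.mul
    (hc.contDiff_convolution_right (ContinuousLinearMap.mul ℝ ℂ) locallyIntegrable_inv hg)

/-- Differentiation under the integral reduces this to `integral_inv_mul_dzbar` for `w ↦ g (z - w)`;
the reflection supplies the minus sign. -/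
theorem dzbar_cauchyTransform {g : ℂ → ℂ} (hg : ContDiff ℝ ∞ g) (hc : HasCompactSupport g)
    (z : ℂ) : dzbar (cauchyTransform g) z = g z := by
  have hg1 : ContDiff ℝ 1 g := hg.of_le (mod_cast le_top)
  have hD := hc.hasFDerivAt_convolution_right (ContinuousLinearMap.mul ℝ ℂ)
    locallyIntegrable_inv hg1 z
  have hint := (hc.fderiv ℝ).convolutionExists_right ((ContinuousLinearMap.mul ℝ ℂ).precompR ℂ)
    locallyIntegrable_inv (hg1.continuous_fderiv one_ne_zero) z
  have happ (v : ℂ) : fderiv ℝ (cauchyTransform g) z v =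
      (Real.pi : ℂ)⁻¹ * ∫ w, w⁻¹ * fderiv ℝ g (z - w) v := by
    have h : HasFDerivAt (cauchyTransform g) _ z := hD.const_mul (Real.pi : ℂ)⁻¹
    rw [h.fderiv, smul_apply, smul_eq_mul, convolution_def,
      ContinuousLinearMap.integral_apply hint]
    simp
  have hi (v : ℂ) : Integrable fun w => w⁻¹ * fderiv ℝ g (z - w) v := by
    simpa using hint.apply_continuousLinearMap v
  have hcomp (w v : ℂ) : fderiv ℝ (fun w => g (z - w)) w v = -fderiv ℝ g (z - w) v := by
    have h := (hg1.differentiable one_ne_zero (z - w)).hasFDerivAt.comp w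
      ((hasFDerivAt_id (𝕜 := ℝ) w).const_sub z)
    have h' : fderiv ℝ (fun w => g (z - w)) w = _ := h.fderiv
    simp [h']
  have key := integral_inv_mul_dzbar (G := fun w => g (z - w)) (by fun_prop)
    (hc.comp_homeomorph (Homeomorph.subLeft z))
  simp only [dzbar, hcomp, sub_zero] at key
  have hpi : (Real.pi : ℂ) ≠ 0 := by simp [Real.pi_ne_zero]
  rw [dzbar, happ, happ]
  have : ∫ w, w⁻¹ * ((1 / 2 : ℂ) * (-fderiv ℝ g (z - w) 1 + Complex.I * -fderiv ℝ g (z - w) Complex.I))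
      = -(1 / 2) * ((∫ w, w⁻¹ * fderiv ℝ g (z - w) 1) +
        Complex.I * ∫ w, w⁻¹ * fderiv ℝ g (z - w) Complex.I) := by
    rw [← integral_const_mul, ← integral_add (hi 1) ((hi _).const_mul _), ← integral_const_mul]
    congr 1 with w
    ring
  rw [this] at key
  have hpi' : (Real.pi : ℂ)⁻¹ * Real.pi = 1 := inv_mul_cancel₀ hpi
  linear_combination -(Real.pi : ℂ)⁻¹ * key + g z * hpi'

/-- The integrand lives on a disc of area `πρ²`, where `|w| ≥ δ`. -/
theorem norm_cauchyTransform_le {g : ℂ → ℂ} {c z : ℂ} {ρ δ S : ℝ} (hρ : 0 ≤ ρ) (hδ : 0 < δ)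
    (hsupp : ∀ ζ, ζ ∉ Metric.closedBall c ρ → g ζ = 0) (hS : ∀ ζ, ‖g ζ‖ ≤ S)
    (hz : ρ + δ ≤ dist z c) : ‖cauchyTransform g z‖ ≤ S * ρ ^ 2 / δ := by
  have hS0 : 0 ≤ S := (norm_nonneg _).trans (hS 0)
  have h1 : ∫ w, w⁻¹ * g (z - w) = ∫ w in Metric.closedBall (z - c) ρ, w⁻¹ * g (z - w) := by
    refine (setIntegral_eq_integral_of_forall_compl_eq_zero fun w hw => ?_).symm
    rw [hsupp, mul_zero]
    contrapose! hw
    rw [Metric.mem_closedBall, dist_eq_norm] at *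
    rwa [← norm_neg, show -(w - (z - c)) = z - w - c by ring]
  have h2 : ‖∫ w in Metric.closedBall (z - c) ρ, w⁻¹ * g (z - w)‖ ≤
      δ⁻¹ * S * volume.real (Metric.closedBall (z - c) ρ) := by
    refine norm_setIntegral_le_of_norm_le_const measure_closedBall_lt_top fun w hw => ?_
    rw [norm_mul, norm_inv]
    refine mul_le_mul (inv_anti₀ hδ ?_) (hS _) (norm_nonneg _) (by positivity)
    rw [Metric.mem_closedBall, dist_eq_norm] at hw
    rw [dist_eq_norm] at hz
    have := norm_sub_norm_le (z - c) w
    rw [norm_sub_rev (z - c) w] at this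
    linarith
  have h3 : volume.real (Metric.closedBall (z - c) ρ) = Real.pi * ρ ^ 2 := by
    rw [Measure.real, Complex.volume_closedBall]
    simp [ENNReal.toReal_ofReal hρ]
    ring
  rw [cauchyTransform, norm_mul, h1, norm_inv, Complex.norm_real, Real.norm_of_nonneg Real.pi_pos.le,
    inv_mul_le_iff₀ Real.pi_pos]
  refine h2.trans_eq ?_
  rw [h3]
  field_simp

end CauchyTransform

/-! ### Small solutions for one disc, and summation of solutions -/

section Dbar
open Set Filter Topology

theorem ContDiffOn.contDiff_mul_of_tsupport_subset {f χ : ℂ → ℂ} {W : Set ℂ} (hW : IsOpen W)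
    (hf : ContDiffOn ℝ ∞ f W) (hχ : ContDiff ℝ ∞ χ) (hs : tsupport χ ⊆ W) :
    ContDiff ℝ ∞ (fun z => f z * χ z) := by
  rw [contDiff_iff_contDiffAt]
  intro z
  by_cases hz : z ∈ tsupport χ
  · exact (hf.contDiffAt (hW.mem_nhds (hs hz))).mul hχ.contDiffAt
  · have h0 : (fun z => f z * χ z) =ᶠ[𝓝 z] fun _ => 0 := by
      filter_upwards [notMem_tsupport_iff_eventuallyEq.1 hz] with w hw
      simp [hw]
    exact contDiffAt_const.congr_of_eventuallyEq h0

/-- Multiplying by the `N`-th power of a holomorphic function `m` after the Cauchy transform, and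
dividing by it before, gives a solution of `v_z̄ = f` that is small where `m` is small. -/
theorem exists_dzbar_eq_small {f m : ℂ → ℂ} {W E : Set ℂ} {c : ℂ} {ρ q ε : ℝ} (hW : IsOpen W)
    (hf : ContDiff ℝ ∞ f) (hρ : 0 < ρ) (hρW : Metric.closedBall c ρ ⊆ W)
    (hsupp : tsupport f ⊆ Metric.closedBall c ρ) (hm : DifferentiableOn ℂ m W)
    (hm0 : ∀ ζ ∈ Metric.closedBall c ρ, m ζ ≠ 0) (hq0 : 0 ≤ q) (hq : q < 1) (hε : 0 < ε)
    (hE : ∀ z ∈ E, 2 * ρ ≤ dist z c ∧ ∀ ζ ∈ Metric.closedBall c ρ, ‖m z‖ ≤ q * ‖m ζ‖) :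
    ∃ v : ℂ → ℂ, ContDiffOn ℝ ∞ v W ∧ (∀ z ∈ W, dzbar v z = f z) ∧ ∀ z ∈ E, ‖v z‖ ≤ ε := by
  have hfc : HasCompactSupport f := (isCompact_closedBall c ρ).of_isClosed_subset
    (isClosed_tsupport f) hsupp
  obtain ⟨S, hS⟩ := hfc.exists_bound_of_continuous hf.continuous
  have hS0 : 0 ≤ S := (norm_nonneg _).trans (hS 0)
  -- On `E` the twisted solution is at most `q^N S ρ`: the ratio of `m` at `z` and on the disc gives
  -- `q^N`, and the distance to the disc is at least `ρ`.
  obtain ⟨N, hN⟩ : ∃ N : ℕ, q ^ N * (S * ρ) ≤ ε := by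
    have h : Tendsto (fun N : ℕ => q ^ N * (S * ρ)) atTop (𝓝 (0 * (S * ρ))) :=
      (tendsto_pow_atTop_nhds_zero_of_lt_one hq0 hq).mul_const _
    rw [zero_mul] at h
    exact (h.eventually (ge_mem_nhds hε)).exists
  set g : ℂ → ℂ := fun ζ => (m ζ ^ N)⁻¹ * f ζ with hg
  have hgs : ContDiff ℝ ∞ g := by
    set V := W ∩ {ζ | m ζ ≠ 0}
    have hV : IsOpen V := hm.continuousOn.isOpen_inter_preimage hW isOpen_ne
    have hmV : ContDiffOn ℝ ∞ (fun ζ => (m ζ ^ N)⁻¹) V :=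
      contDiffOn_real_of_differentiableOn hV
        (((hm.mono inter_subset_left).pow N).inv fun ζ hζ => pow_ne_zero N hζ.2)
    exact hmV.contDiff_mul_of_tsupport_subset hV hf
      fun ζ hζ => ⟨hρW (hsupp hζ), hm0 ζ (hsupp hζ)⟩
  have hgc : HasCompactSupport g := hfc.mul_left
  have hCs := contDiff_cauchyTransform hgs hgc
  refine ⟨fun z => m z ^ N * cauchyTransform g z,
    (contDiffOn_real_of_differentiableOn hW (hm.pow N)).mul hCs.contDiffOn, fun z hz => ?_,
    fun z hz => ?_⟩
  · have hmz : DifferentiableAt ℂ (fun z => m z ^ N) z :=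
      (hm.pow N).differentiableAt (hW.mem_nhds hz)
    rw [dzbar_mul (hmz.restrictScalars ℝ) (hCs.differentiable (by simp) z),
      (differentiableAt_complex_iff_dzbar_eq_zero.1 hmz).2, dzbar_cauchyTransform hgs hgc, zero_mul,
      zero_add, hg]
    by_cases hζ : z ∈ Metric.closedBall c ρ
    · exact mul_inv_cancel_left₀ (pow_ne_zero N (hm0 z hζ)) _
    · simp [image_eq_zero_of_notMem_tsupport fun h => hζ (hsupp h)]
  · obtain ⟨hzc, hzm⟩ := hE z hz
    -- If `m z` vanishes and `N ≠ 0`, so does the solution; otherwise division by `‖m z ^ N‖` is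
    -- allowed.
    by_cases hmz : m z = 0 ∧ N ≠ 0
    · simp [hmz.1, hmz.2, hε.le]
    have hmz' : 0 < ‖m z ^ N‖ := by
      rw [norm_pos_iff]
      rcases not_and_or.1 hmz with h | h
      · exact pow_ne_zero N h
      · simp [not_not.1 h]
    have hb (ζ : ℂ) : ‖g ζ‖ ≤ q ^ N * S / ‖m z ^ N‖ := by
      by_cases hζ : ζ ∈ Metric.closedBall c ρ
      · rw [hg, norm_mul, norm_inv, le_div_iff₀ hmz', norm_pow, norm_pow, inv_mul_eq_div,
          div_mul_eq_mul_div, div_le_iff₀ (pow_pos (norm_pos_iff.2 (hm0 ζ hζ)) N)]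
        calc ‖f ζ‖ * ‖m z‖ ^ N ≤ S * (q * ‖m ζ‖) ^ N :=
              mul_le_mul (hS ζ) (pow_le_pow_left₀ (norm_nonneg _) (hzm ζ hζ) N) (by positivity) hS0
          _ = q ^ N * S * ‖m ζ‖ ^ N := by rw [mul_pow]; ring
      · rw [hg]
        simp only [image_eq_zero_of_notMem_tsupport fun h => hζ (hsupp h), mul_zero, norm_zero]
        positivity
    have := norm_cauchyTransform_le (g := g) (c := c) (z := z) hρ.le hρ
      (fun ζ hζ => by simp [hg, image_eq_zero_of_notMem_tsupport fun h => hζ (hsupp h)]) hb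
      (by linarith)
    rw [norm_mul]
    calc ‖m z ^ N‖ * ‖cauchyTransform g z‖
        ≤ ‖m z ^ N‖ * (q ^ N * S / ‖m z ^ N‖ * ρ ^ 2 / ρ) := by gcongr
      _ = q ^ N * (S * ρ) := by field_simp
      _ ≤ ε := hN

/-- Near a point the terms from `N` on are holomorphic, since `F n` vanishes there, and are
dominated by a geometric series. The tail is therefore holomorphic, and only a finite sum
contributes to `∂̄`. -/
theorem exists_dzbar_eq_of_locally_summable {f : ℂ → ℂ} {W : Set ℂ} {F v : ℕ → ℂ → ℂ}
    (hv : ∀ n, ContDiffOn ℝ ∞ (v n) W) (hvF : ∀ n, ∀ z ∈ W, dzbar (v n) z = F n z)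
    (hloc : ∀ z ∈ W, ∃ V ⊆ W, IsOpen V ∧ z ∈ V ∧ ∃ N : ℕ,
      (∀ w ∈ V, ∑ n ∈ Finset.range N, F n w = f w) ∧
      ∀ n ≥ N, ∀ w ∈ V, F n w = 0 ∧ ‖v n w‖ ≤ (1 / 2) ^ n) :
    ∃ g : ℂ → ℂ, ContDiffOn ℝ ∞ g W ∧ ∀ z ∈ W, dzbar g z = f z := by
  have key : ∀ z ∈ W, ContDiffAt ℝ ∞ (fun w => ∑' n, v n w) z ∧
      dzbar (fun w => ∑' n, v n w) z = f z := by
    intro z hz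
    obtain ⟨V, hVW, hV, hzV, N, hsum, htail⟩ := hloc z hz
    have hVz : V ∈ 𝓝 z := hV.mem_nhds hzV
    have hu : Summable fun n : ℕ => (1 / 2 : ℝ) ^ (n + N) :=
      (summable_nat_add_iff N).2 summable_geometric_two
    have hvd (n : ℕ) (w : ℂ) (hw : w ∈ V) : DifferentiableAt ℝ (v n) w :=
      ((hv n).contDiffAt (mem_of_superset (hV.mem_nhds hw) hVW)).differentiableAt (by simp)
    have hholo (n : ℕ) : DifferentiableOn ℂ (v (n + N)) V := fun w hw =>
      (differentiableAt_complex_iff_dzbar_eq_zero.2 ⟨hvd _ w hw,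
        by rw [hvF _ w (hVW hw), (htail _ (Nat.le_add_left N n) w hw).1]⟩).differentiableWithinAt
    have hT : DifferentiableOn ℂ (fun w => ∑' n, v (n + N) w) V :=
      Complex.differentiableOn_tsum_of_summable_norm hu hholo hV
        fun n w hw => (htail _ (Nat.le_add_left N n) w hw).2
    have heq : (fun w => ∑' n, v n w) =ᶠ[𝓝 z]
        fun w => ∑ n ∈ Finset.range N, v n w + ∑' n, v (n + N) w := by
      filter_upwards [hVz] with w hw
      have hs : Summable fun n => v (n + N) w :=
        Summable.of_norm_bounded hu fun n => (htail _ (Nat.le_add_left N n) w hw).2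
      exact (((summable_nat_add_iff N).1 hs).sum_add_tsum_nat_add N).symm
    have hTz := contDiffOn_real_of_differentiableOn hV hT
    have hS : ContDiffAt ℝ ∞ (fun w => ∑ n ∈ Finset.range N, v n w) z :=
      ContDiffAt.sum fun n _ => (hv n).contDiffAt (mem_of_superset hVz hVW)
    refine ⟨(hS.add (hTz.contDiffAt hVz)).congr_of_eventuallyEq heq, ?_⟩
    rw [dzbar_congr heq, dzbar_add (hS.differentiableAt (by simp))
      ((hTz.contDiffAt hVz).differentiableAt (by simp)),
      dzbar_eq_zero_of_differentiableOn hV hT hzV, add_zero, ← hsum z hzV, dzbar,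
      fderiv_fun_sum fun n _ => hvd n z hzV]
    simp only [sum_apply]
    rw [Finset.mul_sum, ← Finset.sum_add_distrib, Finset.mul_sum]
    exact Finset.sum_congr rfl fun n _ => hvF n z hz
  exact ⟨_, fun z hz => (key z hz).1.contDiffWithinAt, fun z hz => (key z hz).2⟩

end Dbar

/-! ### Solving the `∂̄`-equation on an arbitrary open set -/

section DbarOpen
open Set Filter Topology Metric

/-- The alternative decides where the twisting function has its pole: at infinity if `W` contains a
disc of radius 2 about `c`, otherwise at a nearest point `p` of the complement, with `ρ` a third of
its distance. -/
theorem IsOpen.exists_radius {W : Set ℂ} (hW : IsOpen W) {c : ℂ} (hc : c ∈ W) :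
    ∃ ρ : ℝ, 0 < ρ ∧ ρ ≤ 1 ∧ closedBall c (2 * ρ) ⊆ W ∧ (ρ = 1 ∨ ∃ p ∉ W, dist p c ≤ 3 * ρ) := by
  by_cases h : closedBall c 2 ⊆ W
  · exact ⟨1, one_pos, le_rfl, by simpa using h, Or.inl rfl⟩
  obtain ⟨x, hx, hxW⟩ := not_subset.1 h
  have hcl : IsClosed Wᶜ := hW.isClosed_compl
  have hne : (Wᶜ).Nonempty := ⟨x, hxW⟩
  obtain ⟨p, hp, hpd⟩ := hcl.exists_infDist_eq_dist hne c
  have hpos : 0 < infDist c Wᶜ := (hcl.notMem_iff_infDist_pos hne).1 (not_not.2 hc)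
  have hle : infDist c Wᶜ ≤ 2 := (infDist_le_dist_of_mem hxW).trans (by rwa [dist_comm])
  refine ⟨infDist c Wᶜ / 3, by linarith, by linarith, fun y hy => ?_, Or.inr ⟨p, hp, ?_⟩⟩
  · by_contra hyW
    have h1 : infDist c Wᶜ ≤ dist c y := infDist_le_dist_of_mem hyW
    rw [mem_closedBall, dist_comm] at hy
    linarith
  · rw [dist_comm, ← hpd]
    linarith

/-- Around every point of an open set `W` there is a disc such that `v_z̄ = f` can be solved, for
`f` supported in the disc, with `v` small on a set `E`, and the disc stays in a compact subset of
`W` as long as some point of a given compact subset of `W` is not in `E`. -/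
theorem IsOpen.exists_disc_dzbar {W : Set ℂ} (hW : IsOpen W) {c : ℂ} (hc : c ∈ W) :
    ∃ (ρ : ℝ) (E : Set ℂ), 0 < ρ ∧ closedBall c ρ ⊆ W ∧
      (∀ f : ℂ → ℂ, ContDiff ℝ ∞ f → tsupport f ⊆ closedBall c ρ → ∀ ε : ℝ, 0 < ε →
        ∃ v : ℂ → ℂ, ContDiffOn ℝ ∞ v W ∧ (∀ z ∈ W, dzbar v z = f z) ∧ ∀ z ∈ E, ‖v z‖ ≤ ε) ∧
      ∀ (z : ℂ) (R δ : ℝ), z ∉ E → ‖z‖ ≤ R → δ ≤ 1 → ball z δ ⊆ W →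
        ∀ ζ ∈ closedBall c ρ, ‖ζ‖ ≤ 4 * R + 9 ∧ ball ζ (δ / 5) ⊆ W := by
  obtain ⟨ρ, hρ, hρ1, hρW, hcase⟩ := hW.exists_radius hc
  have hρW' : closedBall c ρ ⊆ W := (closedBall_subset_closedBall (by linarith)).trans hρW
  have hball (ζ : ℂ) (hζ : ζ ∈ closedBall c ρ) : ball ζ ρ ⊆ W := fun w hw => hρW <| by
    rw [mem_closedBall] at *
    rw [mem_ball] at hw
    linarith [dist_triangle w ζ c]
  rcases hcase with rfl | ⟨p, hp, hpc⟩
  · have hnear (z : ℂ) (R δ : ℝ) (hzE : ¬ (4 ≤ ‖c‖ ∧ 4 * ‖z‖ ≤ ‖c‖)) (hzR : ‖z‖ ≤ R) (hδ : δ ≤ 1)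
        (ζ : ℂ) (hζ : ζ ∈ closedBall c 1) : ‖ζ‖ ≤ 4 * R + 9 ∧ ball ζ (δ / 5) ⊆ W := by
      refine ⟨?_, (ball_subset_ball (by linarith)).trans (hball ζ hζ)⟩
      have h1 : ‖ζ‖ ≤ ‖c‖ + 1 := by
        rw [mem_closedBall, dist_eq_norm] at hζ
        linarith [norm_le_norm_add_norm_sub' ζ c]
      rcases not_and_or.1 hzE with h | h <;> linarith [norm_nonneg z]
    -- Here `m = id`: when `‖c‖ ≥ 4`, the disc about `c` has modulus at least `‖c‖ - 1`, more than
    -- twice that of points with `4‖z‖ ≤ ‖c‖`. When `‖c‖ < 4` the set is empty and any solution will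
    -- do.
    refine ⟨1, {z | 4 ≤ ‖c‖ ∧ 4 * ‖z‖ ≤ ‖c‖}, one_pos, hρW', fun f hf hsupp ε hε => ?_,
      fun z R δ hzE hzR hδ _ => hnear z R δ hzE hzR hδ⟩
    by_cases hc4 : 4 ≤ ‖c‖
    · have hζc (ζ : ℂ) (hζ : ζ ∈ closedBall c 1) : ‖c‖ - 1 ≤ ‖ζ‖ := by
        rw [mem_closedBall', dist_eq_norm] at hζ
        linarith [norm_le_norm_add_norm_sub' c ζ]
      refine exists_dzbar_eq_small (m := id) (q := 1 / 2) hW hf one_pos hρW' hsupp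
        differentiableOn_id (fun ζ hζ h0 => ?_) (by norm_num) (by norm_num) hε
        fun z hz => ⟨?_, fun ζ hζ => ?_⟩
      · have := hζc ζ hζ
        rw [id] at h0
        rw [h0, norm_zero] at this
        linarith
      · rw [dist_eq_norm, norm_sub_rev]
        linarith [norm_sub_norm_le c z, hz.2]
      · have := hζc ζ hζ
        simp only [id]
        linarith [hz.2]
    · exact exists_dzbar_eq_small (m := fun _ => 1) (q := 1 / 2) hW hf one_pos hρW' hsupp
        (differentiableOn_const _) (fun _ _ => one_ne_zero) (by norm_num) (by norm_num) hε
        fun z hz => absurd hz.1 hc4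
  -- Here `m = 1/(z - p)`. The disc is within `4ρ` of `p` and `E` is at least `5ρ` away, hence `q =
  -- 4/5`. Points outside `E` are within `9ρ ≤ 9` of each point of the disc, and `δ ≤ 5ρ` because `p
  -- ∉ W`; this explains the bounds `4R + 9` and `δ / 5`.
  · refine ⟨ρ, {z | 5 * ρ ≤ dist z p}, hρ, hρW', fun f hf hsupp ε hε => ?_,
      fun z R δ hzE hzR hδ hzδ ζ hζ => ?_⟩
    · have hne (z : ℂ) (hz : z ∈ W) : z - p ≠ 0 := sub_ne_zero.2 fun h => hp (h ▸ hz)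
      refine exists_dzbar_eq_small (m := fun z => (z - p)⁻¹) (q := 4 / 5) hW hf hρ hρW' hsupp
        (fun z hz => ((differentiableAt_id.sub_const p).inv (hne z hz)).differentiableWithinAt)
        (fun ζ hζ => inv_ne_zero (hne ζ (hρW' hζ))) (by norm_num) (by norm_num) hε
        fun z hz => ⟨?_, fun ζ hζ => ?_⟩
      · have := dist_triangle z c p
        rw [dist_comm c p] at this
        rw [mem_ofPred_eq] at hz
        linarith
      · have h1 : ‖ζ - p‖ ≤ 4 * ρ := by
          rw [← dist_eq_norm]
          rw [mem_closedBall] at hζ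
          have := dist_triangle ζ c p
          rw [dist_comm c p] at this
          linarith
        have h2 : 5 * ρ ≤ ‖z - p‖ := by rwa [← dist_eq_norm]
        have h3 : 0 < ‖ζ - p‖ := norm_pos_iff.2 (hne ζ (hρW' hζ))
        rw [norm_inv, norm_inv, ← div_eq_mul_inv, inv_le_comm₀ (by linarith) (by positivity),
          inv_div, div_le_iff₀ (by norm_num)]
        linarith
    · rw [mem_ofPred_eq, not_le] at hzE
      have hδρ : δ ≤ 5 * ρ := by
        by_contra h
        exact hp (hzδ (by rw [mem_ball, dist_comm]; linarith))
      refine ⟨?_, (ball_subset_ball (by linarith)).trans (hball ζ hζ)⟩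
      rw [mem_closedBall] at hζ
      have h1 := dist_triangle4 ζ c p z
      rw [dist_comm c p, dist_comm p z, dist_eq_norm ζ z] at h1
      linarith [norm_le_norm_add_norm_sub' ζ z, norm_nonneg z]

/-- Telescoping: the functions `b n ∏_{i<n} (1 - b i)` sum to 1 wherever some `b i` equals 1, and
all later ones vanish there. -/
theorem sum_mul_prod_one_sub (b : ℕ → ℂ) (N : ℕ) :
    ∑ n ∈ Finset.range N, b n * ∏ i ∈ Finset.range n, (1 - b i) =
      1 - ∏ i ∈ Finset.range N, (1 - b i) := by
  induction N with
  | zero => simp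
  | succ N ih =>
    rw [Finset.sum_range_succ, Finset.prod_range_succ, ih]
    ring

/-- The equation `g_z̄ = f` has a smooth solution on every open subset of the plane. -/
theorem IsOpen.exists_dzbar_eq {W : Set ℂ} (hW : IsOpen W) {f : ℂ → ℂ}
    (hf : ContDiffOn ℝ ∞ f W) : ∃ g : ℂ → ℂ, ContDiffOn ℝ ∞ g W ∧ ∀ z ∈ W, dzbar g z = f z := by
  choose! ρ E hρ hρW hsolve hnear using fun c (hc : c ∈ W) => hW.exists_disc_dzbar hc
  rcases W.eq_empty_or_nonempty with rfl | hWne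
  · exact ⟨0, by simp, by simp⟩
  obtain ⟨t, htW, htc, htcov⟩ := TopologicalSpace.countable_cover_nhdsWithin (s := W)
    (f := fun x => ball x (ρ x / 2))
    fun x hx => mem_nhdsWithin_of_mem_nhds (ball_mem_nhds x (half_pos (hρ x hx)))
  have htne : t.Nonempty := by
    obtain ⟨x, hx⟩ := hWne
    obtain ⟨c, hc, -⟩ := mem_iUnion₂.1 (htcov hx)
    exact ⟨c, hc⟩
  obtain ⟨c, rfl⟩ := htc.exists_eq_range htne
  have hcW (n : ℕ) : c n ∈ W := htW (mem_range_self n)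
  have hcov : W ⊆ ⋃ n, ball (c n) (ρ (c n) / 2) := by simpa using htcov
  let b (n : ℕ) : ContDiffBump (c n) :=
    ⟨ρ (c n) / 2, ρ (c n), half_pos (hρ _ (hcW n)), half_lt_self (hρ _ (hcW n))⟩
  have hb1 (n : ℕ) (z : ℂ) (hz : z ∈ ball (c n) (ρ (c n) / 2)) : ((b n z : ℝ) : ℂ) = 1 := by
    rw [(b n).one_of_mem_closedBall (ball_subset_closedBall hz), Complex.ofReal_one]
  have hbs (n : ℕ) : ContDiff ℝ ∞ fun z => ((b n z : ℝ) : ℂ) :=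
    Complex.ofRealCLM.contDiff.comp (b n).contDiff
  set χ : ℕ → ℂ → ℂ := fun n z => (b n z : ℝ) * ∏ i ∈ Finset.range n, (1 - ((b i z : ℝ) : ℂ))
    with hχ
  have hχs (n : ℕ) : ContDiff ℝ ∞ (χ n) :=
    (hbs n).mul (contDiff_prod fun i _ => contDiff_const.sub (hbs i))
  have hχt (n : ℕ) : tsupport (χ n) ⊆ closedBall (c n) (ρ (c n)) := by
    refine closure_minimal (fun z hz => ?_) isClosed_closedBall
    have hz' : b n z ≠ 0 := fun h => hz (by simp [hχ, h])
    have := (b n).support_eq ▸ Function.mem_support.2 hz'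
    exact ball_subset_closedBall this
  set F : ℕ → ℂ → ℂ := fun n z => f z * χ n z with hF
  have hFs (n : ℕ) : ContDiff ℝ ∞ (F n) :=
    hf.contDiff_mul_of_tsupport_subset hW (hχs n) ((hχt n).trans (hρW _ (hcW n)))
  have hFt (n : ℕ) : tsupport (F n) ⊆ closedBall (c n) (ρ (c n)) :=
    (closure_mono (Function.support_mul_subset_right _ _)).trans (hχt n)
  have hv (n : ℕ) : ∃ v : ℂ → ℂ, ContDiffOn ℝ ∞ v W ∧ (∀ z ∈ W, dzbar v z = F n z) ∧
      ∀ z, (z ∈ E (c n) ∨ F n = 0) → ‖v z‖ ≤ (1 / 2) ^ n := by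
    -- A zero piece needs the solution zero: its bound must hold also off `E`.
    by_cases h0 : F n = 0
    · exact ⟨0, contDiffOn_const, fun z _ => by simp [h0, dzbar], fun z _ => by simp⟩
    · obtain ⟨v, h1, h2, h3⟩ := hsolve _ (hcW n) (F n) (hFs n) (hFt n) ((1 / 2) ^ n) (by positivity)
      exact ⟨v, h1, h2, fun z hz => h3 z (hz.resolve_right h0)⟩
  choose v hvs hvF hvE using hv
  refine exists_dzbar_eq_of_locally_summable hvs hvF fun z hz => ?_
  obtain ⟨δ', hδ'0, hδ'⟩ := Metric.isOpen_iff.1 hW z hz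
  obtain ⟨δ, hδ0, hδ1, hδδ'⟩ : ∃ δ : ℝ, 0 < δ ∧ δ ≤ 1 ∧ 2 * δ ≤ δ' :=
    ⟨min 1 (δ' / 2), by positivity, min_le_left _ _, by linarith [min_le_right 1 (δ' / 2)]⟩
  set R := ‖z‖ + δ
  -- `K` is the compact set that, by `hnear`, contains every disc whose set `E` misses some point of
  -- `ball z δ`. From some index on all `χ n` vanish on `K`, so such a disc then carries the piece
  -- zero.
  set K := closedBall (0 : ℂ) (4 * R + 9) ∩ {ζ | ball ζ (δ / 5) ⊆ W} with hK
  have hKW : K ⊆ W := fun ζ hζ => hζ.2 (mem_ball_self (by positivity))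
  have hKc : IsCompact K := by
    refine (isCompact_closedBall _ _).inter_right ?_
    -- Having distance at least `δ / 5` from the complement is a closed condition.
    have : {ζ | ball ζ (δ / 5) ⊆ W} = ⋂ p ∈ Wᶜ, {ζ | δ / 5 ≤ dist p ζ} := by
      ext ζ
      simp only [mem_ofPred_eq, mem_iInter]
      constructor
      · intro h p hp
        by_contra hlt
        exact hp (h (mem_ball.2 (not_le.1 hlt)))
      · intro h w hw
        by_contra hwW
        exact absurd (h w hwW) (not_le.2 (mem_ball.1 hw))
    rw [this]
    exact isClosed_biInter fun p _ => isClosed_le continuous_const (by fun_prop)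
  obtain ⟨s, hs⟩ := hKc.elim_finite_subcover (fun n => ball (c n) (ρ (c n) / 2))
    (fun n => isOpen_ball) (hKW.trans hcov)
  obtain ⟨N, hN⟩ : ∃ N : ℕ, ∀ i ∈ s, i < N :=
    ⟨s.sup id + 1, fun i hi => Nat.lt_succ_of_le (Finset.le_sup (f := id) hi)⟩
  have hprod (w : ℂ) (hw : w ∈ K) (n : ℕ) (hn : N ≤ n) :
      ∏ i ∈ Finset.range n, (1 - ((b i w : ℝ) : ℂ)) = 0 := by
    obtain ⟨i, hi, hwi⟩ := mem_iUnion₂.1 (hs hw)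
    exact Finset.prod_eq_zero (Finset.mem_range.2 ((hN i hi).trans_le hn))
      (by rw [hb1 i w hwi, sub_self])
  have hVball (w : ℂ) (hw : w ∈ ball z δ) : ball w δ ⊆ W := fun y hy => hδ' <| by
    rw [mem_ball] at *
    linarith [dist_triangle y w z]
  have hVR (w : ℂ) (hw : w ∈ ball z δ) : ‖w‖ ≤ R := by
    rw [mem_ball, dist_eq_norm] at hw
    linarith [norm_le_norm_add_norm_sub' w z]
  have hVK : ball z δ ⊆ K := fun w hw => by
    refine ⟨?_, (ball_subset_ball (by linarith)).trans (hVball w hw)⟩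
    rw [mem_closedBall_zero_iff]
    linarith [hVR w hw, norm_nonneg w]
  refine ⟨ball z δ, hVK.trans hKW, isOpen_ball, mem_ball_self hδ0, N, fun w hw => ?_,
    fun n hn w hw => ⟨?_, hvE n w ?_⟩⟩
  · simp only [hF, hχ]
    rw [← Finset.mul_sum, sum_mul_prod_one_sub, hprod w (hVK hw) N le_rfl, sub_zero, mul_one]
  · simp only [hF, hχ, hprod w (hVK hw) n hn, mul_zero]
  · by_contra hcon
    obtain ⟨hwE, hF0⟩ := not_or.1 hcon
    refine hF0 (funext fun ζ => ?_)
    by_cases hζ : ζ ∈ closedBall (c n) (ρ (c n))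
    · have h := hnear (c n) (hcW n) w R δ hwE (hVR w hw) hδ1 (hVball w hw) ζ hζ
      simp only [hF, hχ, hprod ζ ⟨mem_closedBall_zero_iff.2 h.1, h.2⟩ n hn, mul_zero, Pi.zero_apply]
    · exact image_eq_zero_of_notMem_tsupport fun h => hζ (hFt n h)

end DbarOpen

/-! ### Recovering `φ` from `ψ`, and the dual Dirac equation -/

section Spinors

theorem ContDiffOn.spinor_apply {χ : ℂ → Fin 2 → ℂ} {W : Set ℂ} (h : ContDiffOn ℝ ∞ χ W)
    (i : Fin 2) : ContDiffOn ℝ ∞ (fun z => χ z i) W :=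
  contDiffOn_pi.1 h i

theorem contDiffOn_conj {f : ℂ → ℂ} {W : Set ℂ} (h : ContDiffOn ℝ ∞ f W) :
    ContDiffOn ℝ ∞ (fun z => conj (f z)) W :=
  Complex.conjCLE.contDiff.comp_contDiffOn h

theorem ContDiffOn.differentiableAt_of_isOpen {f : ℂ → ℂ} {W : Set ℂ} (hW : IsOpen W)
    (h : ContDiffOn ℝ ∞ f W) {z : ℂ} (hz : z ∈ W) : DifferentiableAt ℝ f z :=
  (h.contDiffAt (hW.mem_nhds hz)).differentiableAt (by simp)

theorem dirac_eq_zero_iff {U : ℂ → ℂ} {ψ : ℂ → Fin 2 → ℂ} {z : ℂ} :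
    dirac U ψ z = 0 ↔ dz (fun w => ψ w 1) z + U z * ψ z 0 = 0 ∧
      -dzbar (fun w => ψ w 0) z + conj (U z) * ψ z 1 = 0 := by
  simp [dirac]

theorem diracDual_eq_zero_iff {U : ℂ → ℂ} {φ : ℂ → Fin 2 → ℂ} {z : ℂ} :
    diracDual U φ z = 0 ↔ dz (fun w => φ w 1) z + conj (U z) * φ z 0 = 0 ∧
      -dzbar (fun w => φ w 0) z + U z * φ z 1 = 0 := by
  simp [diracDual]

theorem halfConj_injective : Function.Injective halfConj := by
  intro χ χ' h
  have h0 := congrFun h 0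
  have h1 := congrFun h 1
  simp only [halfConj, Matrix.cons_val_zero, Matrix.cons_val_one] at h0 h1
  ext i
  fin_cases i
  · exact h0
  · exact (starRingEnd ℂ).injective h1

theorem segreVec_mul_eq (a b : Fin 2 → ℂ) :
    a 0 * b 0 = -Complex.I * segreVec a b 0 - segreVec a b 1 ∧
    a 0 * b 1 = segreVec a b 2 + Complex.I * segreVec a b 3 ∧
    a 1 * b 0 = segreVec a b 2 - Complex.I * segreVec a b 3 ∧
    a 1 * b 1 = -Complex.I * segreVec a b 0 + segreVec a b 1 := by
  simp only [segreVec, Matrix.cons_val_zero, Matrix.cons_val_one, Matrix.cons_val]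
  refine ⟨?_, ?_, ?_, ?_⟩
  · linear_combination (1 / 2) * (a 1 * b 1 + a 0 * b 0) * Complex.I_mul_I
  · linear_combination -(1 / 2) * (a 1 * b 0 - a 0 * b 1) * Complex.I_mul_I
  · linear_combination (1 / 2) * (a 1 * b 0 - a 0 * b 1) * Complex.I_mul_I
  · linear_combination (1 / 2) * (a 1 * b 1 + a 0 * b 0) * Complex.I_mul_I

theorem segreVec_smul_smul (s t : ℂ) (a b : Fin 2 → ℂ) :
    segreVec (s • a) (t • b) = (s * t) • segreVec a b := by
  ext i
  fin_cases i <;> simp [segreVec] <;> ring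

theorem normSq_add_normSq_ne_zero {b : Fin 2 → ℂ} (hb : b ≠ 0) :
    b 0 * conj (b 0) + b 1 * conj (b 1) ≠ 0 := by
  rw [Complex.mul_conj, Complex.mul_conj]
  norm_cast
  intro h
  have h0 := Complex.normSq_nonneg (b 0)
  have h1 := Complex.normSq_nonneg (b 1)
  have e0 : b 0 = 0 := Complex.normSq_eq_zero.1 (by linarith)
  have e1 : b 1 = 0 := Complex.normSq_eq_zero.1 (by linarith)
  refine hb ?_
  ext i
  fin_cases i
  · exact e0
  · exact e1

/-- The products `a i * b j` contracted with the conjugate of `b` give `a i * |b|²`. The formula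
shows both uniqueness and smooth dependence of `a`. -/
theorem segreVec_eq_left {a b : Fin 2 → ℂ} (hb : b ≠ 0) :
    a 0 = ((-Complex.I * segreVec a b 0 - segreVec a b 1) * conj (b 0) +
        (segreVec a b 2 + Complex.I * segreVec a b 3) * conj (b 1)) *
        (b 0 * conj (b 0) + b 1 * conj (b 1))⁻¹ ∧
    a 1 = ((segreVec a b 2 - Complex.I * segreVec a b 3) * conj (b 0) +
        (-Complex.I * segreVec a b 0 + segreVec a b 1) * conj (b 1)) *
        (b 0 * conj (b 0) + b 1 * conj (b 1))⁻¹ := by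
  obtain ⟨h00, h01, h10, h11⟩ := segreVec_mul_eq a b
  rw [← h00, ← h01, ← h10, ← h11]
  constructor <;> rw [eq_mul_inv_iff_mul_eq₀ (normSq_add_normSq_ne_zero hb)] <;> ring

theorem segreVec_left_cancel {a a' b : Fin 2 → ℂ} (hb : b ≠ 0)
    (h : segreVec a b = segreVec a' b) : a = a' := by
  have h1 := segreVec_eq_left (a := a) hb
  have h2 := segreVec_eq_left (a := a') hb
  rw [h] at h1
  ext i
  fin_cases i
  · exact h1.1.trans h2.1.symm
  · exact h1.2.trans h2.2.symm

theorem WeierstrassFormula.eqOn {r : ℂ → EuclideanSpace ℝ (Fin 4)} {W : Set ℂ}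
    {ψ φ φ' : ℂ → Fin 2 → ℂ} (h : WeierstrassFormula r W ψ φ) (h' : WeierstrassFormula r W ψ φ')
    (hψ : ∀ z ∈ W, halfConj (ψ z) ≠ 0) : Set.EqOn φ' φ W := fun z hz =>
  halfConj_injective (segreVec_left_cancel (hψ z hz) ((h' z hz).symm.trans (h z hz)))

/-- The projective identity leaves one scalar free; since `b` is prescribed, `a` absorbs it. -/
theorem exists_rz_eq_segreVec {W : Set ℂ} {r : ℂ → EuclideanSpace ℝ (Fin 4)}
    {hr : IsConformalImmersionOn r W} {Gψ Gφ : W → Projectivization ℂ (Fin 2 → ℂ)}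
    (hG : AreGaussComponents hr Gψ Gφ) (z : W) {b : Fin 2 → ℂ} (hb : b ≠ 0)
    (hbG : Gψ z = Projectivization.mk ℂ b hb) :
    ∃ (a : Fin 2 → ℂ) (ha : a ≠ 0), rz r z = segreVec a b ∧
      Gφ z = Projectivization.mk ℂ a ha := by
  have h := hG z
  rw [hbG, ← (Gφ z).mk_rep, segre_mk _ _ (Gφ z).rep_nonzero hb, gaussMap, eq_comm,
    Projectivization.mk_eq_mk_iff'] at h
  obtain ⟨t, ht⟩ := h
  have ht0 : t ≠ 0 := by
    rintro rfl
    exact hr.rz_ne_zero z.2 (by rw [← ht, zero_smul])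
  refine ⟨t • (Gφ z).rep, smul_ne_zero ht0 (Gφ z).rep_nonzero, ?_, ?_⟩
  · have := segreVec_smul_smul t 1 (Gφ z).rep b
    rw [one_smul, mul_one] at this
    rw [this, ht]
  · conv_lhs => rw [← (Gφ z).mk_rep]
    rw [Projectivization.mk_eq_mk_iff']
    exact ⟨t⁻¹, inv_smul_smul₀ ht0 _⟩

/-- The dual Dirac equation follows from the Dirac equation, as `r_{z z̄}` is real. -/
theorem diracDual_eq_zero_of_weierstrass {W : Set ℂ} {r : ℂ → EuclideanSpace ℝ (Fin 4)}
    (hr : IsConformalImmersionOn r W) {ψ φ : ℂ → Fin 2 → ℂ} {U : ℂ → ℂ}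
    (hψ : ContDiffOn ℝ ∞ ψ W) (hφ : ContDiffOn ℝ ∞ φ W) (hψ0 : ∀ z ∈ W, halfConj (ψ z) ≠ 0)
    (hw : WeierstrassFormula r W ψ φ) {z : ℂ} (hz : z ∈ W) (hD : dirac U ψ z = 0) :
    diracDual U φ z = 0 := by
  have hW := hr.isOpen
  have hx (k : Fin 4) : ContDiffOn ℝ ∞ (fun w => r w k) W :=
    (EuclideanSpace.proj k : EuclideanSpace ℝ (Fin 4) →L[ℝ] ℝ).contDiff.comp_contDiffOn hr.smooth
  have hy (k : Fin 4) : DifferentiableAt ℝ (fun w => rz r w k) z :=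
    (contDiffOn_dz hW (Complex.ofRealCLM.contDiff.comp_contDiffOn
      (hx k))).differentiableAt_of_isOpen hW hz
  have hreal (k : Fin 4) : conj (dzbar (fun w => rz r w k) z) = dzbar (fun w => rz r w k) z :=
    conj_dzbar_dz_ofReal hW (hx k) hz
  have hψd (i : Fin 2) : DifferentiableAt ℝ (fun w => ψ w i) z :=
    (hψ.spinor_apply i).differentiableAt_of_isOpen hW hz
  have hφd (i : Fin 2) : DifferentiableAt ℝ (fun w => φ w i) z :=
    (hφ.spinor_apply i).differentiableAt_of_isOpen hW hz
  have hcd {f : ℂ → ℂ} (hf : DifferentiableAt ℝ f z) : DifferentiableAt ℝ (fun w => conj (f w)) z :=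
    Complex.conjCLE.differentiableAt.comp z hf
  have hprod : ∀ w ∈ W, _ := fun w hw' => hw w hw' ▸ segreVec_mul_eq (halfConj (φ w)) (halfConj (ψ w))
  simp only [halfConj, Matrix.cons_val_zero, Matrix.cons_val_one] at hprod
  have h00 := dzbar_congr (Filter.eventually_of_mem (hW.mem_nhds hz) fun w hw => (hprod w hw).1)
  have h01 := dzbar_congr (Filter.eventually_of_mem (hW.mem_nhds hz) fun w hw => (hprod w hw).2.1)
  have h10 := dzbar_congr (Filter.eventually_of_mem (hW.mem_nhds hz) fun w hw => (hprod w hw).2.2.1)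
  have h11 := dzbar_congr (Filter.eventually_of_mem (hW.mem_nhds hz) fun w hw => (hprod w hw).2.2.2)
  rw [dzbar_mul (hφd 0) (hψd 0), dzbar_sub ((hy 0).const_mul _) (hy 1), dzbar_const_mul _ (hy 0)]
    at h00
  rw [dzbar_mul (hφd 0) (hcd (hψd 1)), dzbar_conj, dzbar_add (hy 2) ((hy 3).const_mul _),
    dzbar_const_mul _ (hy 3)] at h01
  rw [dzbar_mul (hcd (hφd 1)) (hψd 0), dzbar_conj, dzbar_sub (hy 2) ((hy 3).const_mul _),
    dzbar_const_mul _ (hy 3)] at h10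
  rw [dzbar_mul (hcd (hφd 1)) (hcd (hψd 1)), dzbar_conj, dzbar_conj,
    dzbar_add ((hy 0).const_mul _) (hy 1), dzbar_const_mul _ (hy 0)] at h11
  have h10c := congrArg conj h10
  have h11c := congrArg conj h11
  simp only [map_add, map_sub, map_mul, map_neg, Complex.conj_I, Complex.conj_conj, hreal] at h10c h11c
  obtain ⟨hD1, hD2⟩ := dirac_eq_zero_iff.1 hD
  have hD1c := congrArg conj hD1
  have hD2c := congrArg conj hD2
  simp only [map_add, map_mul, map_neg, Complex.conj_conj, map_zero] at hD1c hD2c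
  have hne := normSq_add_normSq_ne_zero (hψ0 z hz)
  simp only [halfConj, Matrix.cons_val_zero, Matrix.cons_val_one, Complex.conj_conj] at hne
  rw [diracDual_eq_zero_iff]
  generalize dzbar (fun w => φ w 0) z = A at *
  generalize dz (fun w => φ w 1) z = B at *
  generalize dzbar (fun w => ψ w 0) z = C at *
  generalize dz (fun w => ψ w 1) z = D at *
  generalize φ z 0 = p at *
  generalize φ z 1 = q at *
  generalize ψ z 0 = a at *
  generalize ψ z 1 = b at *
  generalize U z = u at *
  -- With `X = B + ū p` and `Y = A - u q`, the components of `𝒟^∨φ` up to sign, reality of `r_{z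
  -- z̄}` pairs the products 00 with 11 and 01 with 10. The system is `X b + Y a = 0`, `X ā = Y b̄`,
  -- and `|a|² + |b|² ≠ 0` forces `X = Y = 0`.
  have e1 : (B + conj u * p) * b + (A - u * q) * a = 0 := by
    linear_combination h11c + h00 - q * hD1 + p * hD2
  have e2 : (B + conj u * p) * conj a = (A - u * q) * conj b := by
    linear_combination h10c - h01 + q * hD2c + p * hD1c
  have e3 : B + conj u * p = 0 := by
    refine (mul_eq_zero.1 ?_).resolve_right hne
    linear_combination conj b * e1 + a * e2
  refine ⟨e3, ?_⟩
  have e4 : A - u * q = 0 := by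
    refine (mul_eq_zero.1 ?_).resolve_right hne
    linear_combination conj a * e1 - b * e2
  linear_combination -e4

theorem exists_isDiracLift {W : Set ℂ} {r : ℂ → EuclideanSpace ℝ (Fin 4)}
    {hr : IsConformalImmersionOn r W} {Gψ Gφ : W → Projectivization ℂ (Fin 2 → ℂ)}
    (hG : AreGaussComponents hr Gψ Gφ) {ψ : ℂ → Fin 2 → ℂ} {U : ℂ → ℂ}
    (hψ : ContDiffOn ℝ ∞ ψ W) (hrep : Represents ψ Gψ) (hD : ∀ z ∈ W, dirac U ψ z = 0) :
    ∃ φ : ℂ → Fin 2 → ℂ, IsDiracLift r Gψ Gφ ψ φ U := by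
  have hW := hr.isOpen
  have hψ0 : ∀ z ∈ W, halfConj (ψ z) ≠ 0 := fun z hz => (hrep ⟨z, hz⟩).1
  have hfac : ∀ z, ∃ a : Fin 2 → ℂ, ∀ hz : z ∈ W, ∃ ha : a ≠ 0,
      rz r z = segreVec a (halfConj (ψ z)) ∧ Gφ ⟨z, hz⟩ = Projectivization.mk ℂ a ha := by
    intro z
    by_cases hz : z ∈ W
    · obtain ⟨hb, hbG⟩ := hrep ⟨z, hz⟩
      obtain ⟨a, ha, h⟩ := exists_rz_eq_segreVec hG ⟨z, hz⟩ hb hbG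
      exact ⟨a, fun _ => ⟨ha, h⟩⟩
    · exact ⟨0, fun h => absurd h hz⟩
  choose a ha using hfac
  have hhalf (z : ℂ) : halfConj (halfConj (a z)) = a z := by
    ext i
    fin_cases i <;> simp [halfConj]
  have hy (k : Fin 4) : ContDiffOn ℝ ∞ (fun w => rz r w k) W :=
    contDiffOn_dz hW (Complex.ofRealCLM.contDiff.comp_contDiffOn
      ((EuclideanSpace.proj k : EuclideanSpace ℝ (Fin 4) →L[ℝ] ℝ).contDiff.comp_contDiffOn
        hr.smooth))
  have hψc (i : Fin 2) : ContDiffOn ℝ ∞ (fun w => halfConj (ψ w) i) W := by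
    fin_cases i
    · exact hψ.spinor_apply 0
    · exact contDiffOn_conj (hψ.spinor_apply 1)
  have hinv : ContDiffOn ℝ ∞ (fun w => (halfConj (ψ w) 0 * conj (halfConj (ψ w) 0) +
      halfConj (ψ w) 1 * conj (halfConj (ψ w) 1))⁻¹) W :=
    (((hψc 0).mul (contDiffOn_conj (hψc 0))).add ((hψc 1).mul (contDiffOn_conj (hψc 1)))).inv
      fun z hz => normSq_add_normSq_ne_zero (hψ0 z hz)
  -- The pointwise choice of `a` is smooth because on `W` it agrees with the explicit formula of
  -- `segreVec_eq_left`.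
  have ha0 : ContDiffOn ℝ ∞ (fun w => a w 0) W := by
    refine ContDiffOn.congr (((((contDiffOn_const (c := -Complex.I)).mul (hy 0)).sub (hy 1)).mul
      (contDiffOn_conj (hψc 0))).add (((hy 2).add ((contDiffOn_const (c := Complex.I)).mul
        (hy 3))).mul (contDiffOn_conj (hψc 1))) |>.mul hinv) fun z hz => ?_
    have h := (segreVec_eq_left (a := a z) (hψ0 z hz)).1
    rw [← (ha z hz).2.1] at h
    exact h
  have ha1 : ContDiffOn ℝ ∞ (fun w => a w 1) W := by
    refine ContDiffOn.congr ((((hy 2).sub ((contDiffOn_const (c := Complex.I)).mul (hy 3))).mul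
      (contDiffOn_conj (hψc 0))).add ((((contDiffOn_const (c := -Complex.I)).mul (hy 0)).add
        (hy 1)).mul (contDiffOn_conj (hψc 1))) |>.mul hinv) fun z hz => ?_
    have h := (segreVec_eq_left (a := a z) (hψ0 z hz)).2
    rw [← (ha z hz).2.1] at h
    exact h
  have hφ : ContDiffOn ℝ ∞ (fun z => halfConj (a z)) W := by
    refine contDiffOn_pi.2 fun i => ?_
    fin_cases i
    · exact ha0
    · exact contDiffOn_conj ha1
  have hw : WeierstrassFormula r W ψ fun z => halfConj (a z) := fun z hz => by
    rw [hhalf]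
    exact (ha z hz).2.1
  refine ⟨fun z => halfConj (a z), hψ, hφ, hrep, fun z => ?_, hw, hD,
    fun z hz => diracDual_eq_zero_of_weierstrass hr hψ hφ hψ0 hw hz (hD z hz)⟩
  obtain ⟨h1, -, h2⟩ := ha z z.2
  simp only [hhalf]
  exact ⟨h1, h2⟩

end Spinors

/-! ### Gauge transformations -/

section Gauge

/-- The gauge transformation of a spinor. -/
noncomputable def gaugeVec (h : ℂ) (χ : Fin 2 → ℂ) : Fin 2 → ℂ :=
  ![Complex.exp h * χ 0, Complex.exp (conj h) * χ 1]

/-- The conjugate in the second component is what turns the gauge action into a scalar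
multiplication of the vector representing the point of `ℂP¹`. -/
theorem halfConj_gaugeVec (h : ℂ) (χ : Fin 2 → ℂ) :
    halfConj (gaugeVec h χ) = Complex.exp h • halfConj χ := by
  ext i
  fin_cases i
  · simp [halfConj, gaugeVec]
  · simp [halfConj, gaugeVec, ← Complex.exp_conj]

theorem gaugeRelated_iff {W : Set ℂ} {h : ℂ → ℂ} {ψ φ ψ' φ' : ℂ → Fin 2 → ℂ} {U U' : ℂ → ℂ} :
    GaugeRelated W h ψ φ U ψ' φ' U' ↔ ∀ z ∈ W, ψ' z = gaugeVec (h z) (ψ z) ∧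
      φ' z = gaugeVec (-h z) (φ z) ∧ U' z = Complex.exp (conj (h z) - h z) * U z := by
  simp only [GaugeRelated, gaugeVec, map_neg]

theorem SurfaceR4.Represents.gauge {W : Set ℂ} {χ χ' : ℂ → Fin 2 → ℂ} {h : ℂ → ℂ}
    {G : W → Projectivization ℂ (Fin 2 → ℂ)} (hχ : Represents χ G)
    (hχ' : ∀ z ∈ W, χ' z = gaugeVec (h z) (χ z)) : Represents χ' G := by
  intro z
  obtain ⟨h0, hz⟩ := hχ z
  have e : halfConj (χ' z) = Complex.exp (h z) • halfConj (χ z) := by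
    rw [hχ' z z.2, halfConj_gaugeVec]
  refine ⟨e ▸ smul_ne_zero (Complex.exp_ne_zero _) h0, ?_⟩
  rw [hz, Projectivization.mk_eq_mk_iff']
  exact ⟨Complex.exp (-h z), by rw [e, smul_smul, ← Complex.exp_add]; simp⟩

theorem contDiffOn_gaugeVec {W : Set ℂ} {χ : ℂ → Fin 2 → ℂ} {h : ℂ → ℂ}
    (hχ : ContDiffOn ℝ ∞ χ W) (hh : ContDiffOn ℝ ∞ h W) :
    ContDiffOn ℝ ∞ (fun z => gaugeVec (h z) (χ z)) W := by
  refine contDiffOn_pi.2 fun i => ?_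
  fin_cases i
  · exact hh.cexp.mul (hχ.spinor_apply 0)
  · exact (contDiffOn_conj hh).cexp.mul (hχ.spinor_apply 1)

/-- Derivatives of gauge transformed spinors. -/
theorem deriv_gaugeVec {W : Set ℂ} (hW : IsOpen W) {χ χ' : ℂ → Fin 2 → ℂ} {h : ℂ → ℂ}
    (hχ : ContDiffOn ℝ ∞ χ W) (hh : ContDiffOn ℝ ∞ h W)
    (hχ' : ∀ z ∈ W, χ' z = gaugeVec (h z) (χ z)) {z : ℂ} (hz : z ∈ W) :
    dzbar (fun w => χ' w 0) z =
      Complex.exp (h z) * (dzbar h z * χ z 0 + dzbar (fun w => χ w 0) z) ∧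
    dz (fun w => χ' w 1) z =
      Complex.exp (conj (h z)) * (conj (dzbar h z) * χ z 1 + dz (fun w => χ w 1) z) := by
  have hd := hh.differentiableAt_of_isOpen hW hz
  have hcd := (contDiffOn_conj hh).differentiableAt_of_isOpen hW hz
  have hχd (i : Fin 2) := (hχ.spinor_apply i).differentiableAt_of_isOpen hW hz
  have e0 : (fun w => χ' w 0) =ᶠ[nhds z] fun w => Complex.exp (h w) * χ w 0 :=
    Filter.eventually_of_mem (hW.mem_nhds hz) fun w hw => by simp [hχ' w hw, gaugeVec]
  have e1 : (fun w => χ' w 1) =ᶠ[nhds z] fun w => Complex.exp (conj (h w)) * χ w 1 :=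
    Filter.eventually_of_mem (hW.mem_nhds hz) fun w hw => by simp [hχ' w hw, gaugeVec]
  rw [dzbar_congr e0, dz_congr e1, dzbar_mul hd.cexp (hχd 0), dz_mul hcd.cexp (hχd 1),
    dzbar_comp (Complex.hasDerivAt_exp _) hd, dz_comp (Complex.hasDerivAt_exp _) hcd, dz_conj]
  constructor <;> ring

/-- The factors `e^h` and `e^{-h}` cancel in the Segre vector. As `h_z̄ = 0`, only exponential
factors remain in the Dirac equations, and `e^{h̄ - h}` in `U'` balances them. -/
theorem SurfaceR4.IsDiracLift.gauge {W : Set ℂ} (hW : IsOpen W) {r : ℂ → EuclideanSpace ℝ (Fin 4)}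
    {Gψ Gφ : W → Projectivization ℂ (Fin 2 → ℂ)} {ψ φ ψ' φ' : ℂ → Fin 2 → ℂ} {U U' h : ℂ → ℂ}
    (hL : IsDiracLift r Gψ Gφ ψ φ U) (hh : DifferentiableOn ℂ h W)
    (hg : GaugeRelated W h ψ φ U ψ' φ' U') : IsDiracLift r Gψ Gφ ψ' φ' U' := by
  rw [gaugeRelated_iff] at hg
  have hhs := contDiffOn_real_of_differentiableOn hW hh
  have hψ' : ∀ z ∈ W, ψ' z = gaugeVec (h z) (ψ z) := fun z hz => (hg z hz).1
  have hφ' : ∀ z ∈ W, φ' z = gaugeVec (-h z) (φ z) := fun z hz => (hg z hz).2.1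
  have hexp (z : ℂ) : Complex.exp (-h z) * Complex.exp (h z) = 1 := by
    rw [← Complex.exp_add]
    simp
  have hU' : ∀ z ∈ W, conj (U' z) = Complex.exp (h z - conj (h z)) * conj (U z) := fun z hz => by
    rw [(hg z hz).2.2, map_mul, ← Complex.exp_conj, map_sub, Complex.conj_conj]
  refine ⟨(contDiffOn_gaugeVec hL.smooth_psi hhs).congr hψ',
    (contDiffOn_gaugeVec hL.smooth_phi hhs.neg).congr hφ', hL.represents_psi.gauge hψ',
    hL.represents_phi.gauge hφ', fun z hz => ?_, fun z hz => ?_, fun z hz => ?_⟩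
  · rw [hψ' z hz, hφ' z hz, halfConj_gaugeVec, halfConj_gaugeVec, segreVec_smul_smul, hexp,
      one_smul, hL.weierstrass z hz]
  · obtain ⟨e0, e1⟩ := deriv_gaugeVec hW hL.smooth_psi hhs hψ' hz
    obtain ⟨d1, d2⟩ := dirac_eq_zero_iff.1 (hL.dirac_psi z hz)
    have m1 : Complex.exp (conj (h z) - h z) * Complex.exp (h z) = Complex.exp (conj (h z)) := by
      rw [← Complex.exp_add, sub_add_cancel]
    have m2 : Complex.exp (h z - conj (h z)) * Complex.exp (conj (h z)) = Complex.exp (h z) := by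
      rw [← Complex.exp_add, sub_add_cancel]
    rw [dirac_eq_zero_iff, e0, e1, hU' z hz, (hg z hz).2.2, hψ' z hz,
      dzbar_eq_zero_of_differentiableOn hW hh hz]
    simp only [gaugeVec, Matrix.cons_val_zero, Matrix.cons_val_one, map_zero]
    constructor
    · linear_combination Complex.exp (conj (h z)) * d1 + U z * ψ z 0 * m1
    · linear_combination Complex.exp (h z) * d2 + conj (U z) * ψ z 1 * m2
  · obtain ⟨e0, e1⟩ := deriv_gaugeVec hW hL.smooth_phi hhs.neg hφ' hz
    obtain ⟨d1, d2⟩ := diracDual_eq_zero_iff.1 (hL.dirac_phi z hz)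
    have m1 : Complex.exp (h z - conj (h z)) * Complex.exp (-h z) = Complex.exp (-conj (h z)) := by
      rw [← Complex.exp_add]
      congr 1
      ring
    have m2 : Complex.exp (conj (h z) - h z) * Complex.exp (-conj (h z)) = Complex.exp (-h z) := by
      rw [← Complex.exp_add]
      congr 1
      ring
    have hneg : DifferentiableOn ℂ (fun z => -h z) W := hh.neg
    rw [diracDual_eq_zero_iff, e0, e1, hU' z hz, (hg z hz).2.2, hφ' z hz,
      dzbar_eq_zero_of_differentiableOn hW hneg hz]
    simp only [gaugeVec, Matrix.cons_val_zero, Matrix.cons_val_one, map_zero, map_neg]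
    constructor
    · linear_combination Complex.exp (-conj (h z)) * d1 + conj (U z) * φ z 0 * m1
    · linear_combination Complex.exp (-h z) * d2 + U z * φ z 1 * m2

/-- Two lifts whose `ψ`-components are related by a smooth `h` are gauge related, and `h` is
holomorphic. -/
theorem SurfaceR4.IsDiracLift.gaugeRelated {W : Set ℂ} (hW : IsOpen W) {r : ℂ → EuclideanSpace ℝ (Fin 4)}
    {Gψ Gφ : W → Projectivization ℂ (Fin 2 → ℂ)} {ψ φ ψ' φ' : ℂ → Fin 2 → ℂ} {U U' h : ℂ → ℂ}
    (hL : IsDiracLift r Gψ Gφ ψ φ U) (hL' : IsDiracLift r Gψ Gφ ψ' φ' U')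
    (hh : ContDiffOn ℝ ∞ h W) (hψ' : ∀ z ∈ W, ψ' z = gaugeVec (h z) (ψ z)) :
    DifferentiableOn ℂ h W ∧ GaugeRelated W h ψ φ U ψ' φ' U' := by
  have key : ∀ z ∈ W, dzbar h z = 0 ∧ U' z = Complex.exp (conj (h z) - h z) * U z := by
    intro z hz
    obtain ⟨e0, e1⟩ := deriv_gaugeVec hW hL.smooth_psi hh hψ' hz
    obtain ⟨d1, d2⟩ := dirac_eq_zero_iff.1 (hL.dirac_psi z hz)
    obtain ⟨d1', d2'⟩ := dirac_eq_zero_iff.1 (hL'.dirac_psi z hz)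
    rw [e1, hψ' z hz] at d1'
    rw [e0, hψ' z hz] at d2'
    have hne := normSq_add_normSq_ne_zero (hL.represents_psi ⟨z, hz⟩).1
    simp only [halfConj, gaugeVec, Matrix.cons_val_zero, Matrix.cons_val_one,
      Complex.conj_conj] at hne d1' d2'
    have c1 := congrArg conj d1
    have c1' := congrArg conj d1'
    simp only [map_add, map_mul, Complex.conj_conj, map_zero, ← Complex.exp_conj] at c1 c1'
    have n1 := Complex.exp_ne_zero (h z)
    have n2 := Complex.exp_ne_zero (conj (h z))
    have ec : conj (Complex.exp (h z)) = Complex.exp (conj (h z)) := (Complex.exp_conj _).symm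
    rw [Complex.exp_sub, div_mul_eq_mul_div, eq_div_iff n1, ← ec]
    rw [← ec] at n2 d2' c1'
    generalize dzbar h z = p at *
    generalize dzbar (fun w => ψ w 0) z = A at *
    generalize dz (fun w => ψ w 1) z = B at *
    generalize Complex.exp (h z) = E at *
    generalize ψ z 0 = a at *
    generalize ψ z 1 = b at *
    generalize U z = u at *
    generalize U' z = u' at *
    -- Both relations are linear in `E p` and `X = ū' Ē - E ū`: `E p a = X b` and `E p b̄ = -X ā`.
    -- The determinant is again `|a|² + |b|²` up to sign.
    have f1 : E * p * a = (conj u' * conj E - E * conj u) * b := by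
      linear_combination E * d2 - d2'
    have f2 : E * p * conj b = -(conj u' * conj E - E * conj u) * conj a := by
      linear_combination c1' - E * c1
    have hp : p = 0 := by
      have : E * p * (a * conj a + conj b * b) = 0 := by
        linear_combination conj a * f1 + b * f2
      simpa [n1, hne] using this
    refine ⟨hp, ?_⟩
    have hX : conj u' * conj E - E * conj u = 0 := by
      refine (mul_eq_zero.1 ?_).resolve_right hne
      linear_combination -conj b * f1 + a * f2
    have := congrArg conj hX
    simp only [map_sub, map_mul, Complex.conj_conj, map_zero] at this
    linear_combination this
  refine ⟨fun z hz => (differentiableAt_complex_iff_dzbar_eq_zero.2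
    ⟨hh.differentiableAt_of_isOpen hW hz, (key z hz).1⟩).differentiableWithinAt,
    gaugeRelated_iff.2 fun z hz => ⟨hψ' z hz, ?_, (key z hz).2⟩⟩
  refine halfConj_injective (segreVec_left_cancel (hL'.represents_psi ⟨z, hz⟩).1 ?_)
  rw [← hL'.weierstrass z hz, hψ' z hz, halfConj_gaugeVec, halfConj_gaugeVec, segreVec_smul_smul,
    ← Complex.exp_add, neg_add_cancel, Complex.exp_zero, one_smul, hL.weierstrass z hz]

/-- By continuity `h w - h z` has imaginary part below `π` in modulus near `z`, so there `h` is the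
principal logarithm of `l w / l z` plus a constant. -/
theorem ContinuousOn.contDiffOn_of_exp {W : Set ℂ} (hW : IsOpen W) {h l : ℂ → ℂ}
    (hh : ContinuousOn h W) (hl : ContDiffOn ℝ ∞ l W) (he : ∀ z ∈ W, Complex.exp (h z) = l z) :
    ContDiffOn ℝ ∞ h W := by
  intro z hz
  have hWz := hW.mem_nhds hz
  have hc : ContinuousAt (fun w => h w - h z) z := (hh.continuousAt hWz).sub continuousAt_const
  have him : ∀ᶠ w in nhds z, |(h w - h z).im| < Real.pi := by
    have : ContinuousAt (fun w => |(h w - h z).im|) z :=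
      (Complex.continuous_im.continuousAt.comp hc).abs
    exact this.eventually_lt continuousAt_const (by simp [Real.pi_pos])
  have heq : h =ᶠ[nhds z] fun w => Complex.log (l w / l z) + h z := by
    filter_upwards [him, hWz] with w hw hwW
    obtain ⟨h1, h2⟩ := abs_lt.1 hw
    rw [← he w hwW, ← he z hz, ← Complex.exp_sub, Complex.log_exp h1 h2.le, sub_add_cancel]
  have hlz : l z ≠ 0 := he z hz ▸ Complex.exp_ne_zero _
  have hdiv : ContDiffAt ℝ ∞ (fun w => l w / l z) z := by
    simpa only [div_eq_mul_inv] using (hl.contDiffAt hWz).mul contDiffAt_const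
  have hlog : ContDiffAt ℝ ∞ Complex.log (l z / l z) := by
    rw [div_self hlz]
    exact (Complex.contDiffAt_log (n := ∞) Complex.one_mem_slitPlane).restrict_scalars ℝ
  exact (((hlog.comp z hdiv).add contDiffAt_const).congr_of_eventuallyEq heq).contDiffWithinAt

theorem SurfaceR4.IsDiracLift.exists_gaugeRelated {W : Set ℂ} (hW : IsOpen W) (hsc : IsSimplyConnected W)
    {r : ℂ → EuclideanSpace ℝ (Fin 4)} {Gψ Gφ : W → Projectivization ℂ (Fin 2 → ℂ)}
    {ψ φ ψ' φ' : ℂ → Fin 2 → ℂ} {U U' : ℂ → ℂ} (hL : IsDiracLift r Gψ Gφ ψ φ U)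
    (hL' : IsDiracLift r Gψ Gφ ψ' φ' U') :
    ∃ h : ℂ → ℂ, DifferentiableOn ℂ h W ∧ GaugeRelated W h ψ φ U ψ' φ' U' := by
  -- The hermitian projection of `halfConj ψ'` onto `halfConj ψ`: it equals the proportionality
  -- factor, and it is visibly smooth.
  set l : ℂ → ℂ := fun z => (ψ' z 0 * conj (ψ z 0) + conj (ψ' z 1) * ψ z 1) *
    (ψ z 0 * conj (ψ z 0) + conj (ψ z 1) * ψ z 1)⁻¹ with hl
  have hne : ∀ z ∈ W, ψ z 0 * conj (ψ z 0) + conj (ψ z 1) * ψ z 1 ≠ 0 := fun z hz => by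
    simpa [halfConj] using normSq_add_normSq_ne_zero (hL.represents_psi ⟨z, hz⟩).1
  have hls : ContDiffOn ℝ ∞ l W := by
    have h (i : Fin 2) := hL.smooth_psi.spinor_apply i
    have h' (i : Fin 2) := hL'.smooth_psi.spinor_apply i
    exact (((h' 0).mul (contDiffOn_conj (h 0))).add ((contDiffOn_conj (h' 1)).mul (h 1))).mul
      ((((h 0).mul (contDiffOn_conj (h 0))).add ((contDiffOn_conj (h 1)).mul (h 1))).inv hne)
  have hlψ : ∀ z ∈ W, l z ≠ 0 ∧ halfConj (ψ' z) = l z • halfConj (ψ z) := by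
    intro z hz
    obtain ⟨h0, e0⟩ := hL.represents_psi ⟨z, hz⟩
    obtain ⟨h1, e1⟩ := hL'.represents_psi ⟨z, hz⟩
    rw [e0, eq_comm, Projectivization.mk_eq_mk_iff'] at e1
    obtain ⟨t, ht⟩ := e1
    have hlt : l z = t := by
      have t0 := congrFun ht 0
      have t1 := congrFun ht 1
      simp only [halfConj, Matrix.cons_val_zero, Matrix.cons_val_one, Pi.smul_apply,
        smul_eq_mul] at t0 t1
      simp only [hl]
      rw [mul_inv_eq_iff_eq_mul₀ (hne z hz), ← t0, ← t1]
      ring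
    rw [hlt]
    refine ⟨?_, ht.symm⟩
    rintro rfl
    exact h1 (by rw [← ht, zero_smul])
  obtain ⟨h, hhc, hhe⟩ := Complex.exists_continuousOn_eqOn_exp_comp hsc hW hls.continuousOn
    (by rintro ⟨z, hz, h0⟩; exact (hlψ z hz).1 h0)
  refine ⟨h, hL.gaugeRelated hW hL' (hhc.contDiffOn_of_exp hW hls fun z hz => hhe hz)
    fun z hz => halfConj_injective ?_⟩
  rw [halfConj_gaugeVec, (hlψ z hz).2, ← hhe hz, Function.comp_apply]

end Gauge

/-! ### Lifts in spherical coordinates -/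

section Spherical

theorem halfConj_liftOf (θ η : ℂ → ℝ) (g : ℂ → ℂ) (z : ℂ) :
    halfConj (liftOf θ η g z) = Complex.exp (g z) • sphericalVec (θ z) (η z) := by
  ext i
  fin_cases i
  · simp [halfConj, liftOf, sphericalVec, Complex.exp_add, mul_assoc]
  · simp [halfConj, liftOf, sphericalVec, ← Complex.exp_conj, -Complex.ofReal_sin]

theorem represents_liftOf {W : Set ℂ} {G : W → Projectivization ℂ (Fin 2 → ℂ)} {θ η : ℂ → ℝ}
    (hG : ∀ z : W, G z = sphericalPoint (θ z) (η z)) (g : ℂ → ℂ) :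
    Represents (liftOf θ η g) G := by
  intro z
  have e := halfConj_liftOf θ η g z
  refine ⟨e ▸ smul_ne_zero (Complex.exp_ne_zero _) (sphericalVec_ne_zero _ _), ?_⟩
  rw [hG z, sphericalPoint, Projectivization.mk_eq_mk_iff']
  exact ⟨Complex.exp (-g z), by rw [e, smul_smul, ← Complex.exp_add]; simp⟩

/-- Two spherical lifts come with the logarithm `g' - g` of their ratio, so no topology of `W` is
needed. -/
theorem liftOf_eq_gaugeVec (θ η : ℂ → ℝ) (g g' : ℂ → ℂ) (z : ℂ) :
    liftOf θ η g' z = gaugeVec (g' z - g z) (liftOf θ η g z) := by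
  apply halfConj_injective
  rw [halfConj_gaugeVec, halfConj_liftOf, halfConj_liftOf, smul_smul, ← Complex.exp_add,
    sub_add_cancel]

theorem potentialOf_add (θ η : ℂ → ℝ) (g h : ℂ → ℂ) (z : ℂ) :
    potentialOf θ η (fun w => g w + h w) z =
      Complex.exp (conj (h z) - h z) * potentialOf θ η g z := by
  simp only [potentialOf, map_add]
  rw [show conj (g z) + conj (h z) - (g z + h z) - Complex.I * θ z =
    (conj (h z) - h z) + (conj (g z) - g z - Complex.I * θ z) by ring, Complex.exp_add]
  ring

/-- After conjugating the first equation, the two are linear in `g_z̄` and `Ū e^{ḡ}`, and up to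
exponential factors the matrix is a rotation by entries `sin η`, `cos η`. Hence they determine both
unknowns, also where the sine or cosine vanishes. -/
theorem dirac_liftOf_eq_zero_iff {θ η : ℂ → ℝ} {g U : ℂ → ℂ} {z : ℂ}
    (hθ : DifferentiableAt ℝ (fun w => (θ w : ℂ)) z)
    (hη : DifferentiableAt ℝ (fun w => (η w : ℂ)) z) (hg : DifferentiableAt ℝ g z) :
    dirac U (liftOf θ η g) z = 0 ↔
      dzbar g z = -Complex.I * dzbar (fun w => (θ w : ℂ)) z * (Real.cos (η z) : ℂ) ^ 2 ∧
        U z = potentialOf θ η g z := by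
  have hgc : DifferentiableAt ℝ (fun w => conj (g w)) z :=
    Complex.conjCLE.differentiableAt.comp z hg
  have hsin : DifferentiableAt ℝ (fun w => Complex.sin (η w)) z :=
    ((Complex.differentiable_sin _).restrictScalars ℝ).comp z hη
  have hcos : DifferentiableAt ℝ (fun w => Complex.cos (η w)) z :=
    ((Complex.differentiable_cos _).restrictScalars ℝ).comp z hη
  have hsum : DifferentiableAt ℝ (fun w => g w + Complex.I * θ w) z := hg.add (hθ.const_mul _)
  have hθc : conj (dz (fun w => (θ w : ℂ)) z) = dzbar (fun w => (θ w : ℂ)) z := by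
    rw [← dzbar_conj]
    simp
  have hηc : conj (dz (fun w => (η w : ℂ)) z) = dzbar (fun w => (η w : ℂ)) z := by
    rw [← dzbar_conj]
    simp
  have e1 : dz (fun w => liftOf θ η g w 1) z = Complex.exp (conj (g z)) *
      (conj (dzbar g z) * Complex.sin (η z) + Complex.cos (η z) * dz (fun w => (η w : ℂ)) z) := by
    simp only [liftOf, Matrix.cons_val_one, Matrix.cons_val_fin_one, Complex.ofReal_sin]
    rw [dz_mul hgc.cexp hsin, dz_comp (Complex.hasDerivAt_exp _) hgc,
      dz_comp (Complex.hasDerivAt_sin _) hη, dz_conj]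
    ring
  have e0 : dzbar (fun w => liftOf θ η g w 0) z = Complex.exp (g z + Complex.I * θ z) *
      ((dzbar g z + Complex.I * dzbar (fun w => (θ w : ℂ)) z) * Complex.cos (η z) -
        Complex.sin (η z) * dzbar (fun w => (η w : ℂ)) z) := by
    simp only [liftOf, Matrix.cons_val_zero, Complex.ofReal_cos]
    rw [dzbar_mul hsum.cexp hcos, dzbar_comp (Complex.hasDerivAt_exp _) hsum,
      dzbar_comp (Complex.hasDerivAt_cos _) hη, dzbar_add hg (hθ.const_mul _),
      dzbar_const_mul _ hθ]
    ring
  have hcs : Complex.sin (η z) ^ 2 + Complex.cos (η z) ^ 2 = 1 := Complex.sin_sq_add_cos_sq _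
  have hsc : conj (Complex.sin (η z)) = Complex.sin (η z) := by
    rw [← Complex.sin_conj, Complex.conj_ofReal]
  have hcc : conj (Complex.cos (η z)) = Complex.cos (η z) := by
    rw [← Complex.cos_conj, Complex.conj_ofReal]
  have hTc : conj (Complex.exp (Complex.I * θ z)) = (Complex.exp (Complex.I * θ z))⁻¹ := by
    rw [← Complex.exp_conj, ← Complex.exp_neg]
    simp
  rw [dirac_eq_zero_iff, e0, e1]
  simp only [liftOf, potentialOf, Matrix.cons_val_zero, Matrix.cons_val_one, Complex.exp_add,
    Complex.exp_sub, Complex.exp_conj, Complex.ofReal_sin, Complex.ofReal_cos, ← hθc, ← hηc]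
  have hE := Complex.exp_ne_zero (g z)
  have hT := Complex.exp_ne_zero (Complex.I * θ z)
  generalize Complex.exp (g z) = E at *
  generalize Complex.exp (Complex.I * θ z) = T at *
  generalize Complex.sin (η z) = s at *
  generalize Complex.cos (η z) = c at *
  generalize dz (fun w => (θ w : ℂ)) z = t at *
  generalize dz (fun w => (η w : ℂ)) z = n at *
  generalize dzbar g z = p at *
  generalize U z = u
  clear e0 e1 hθc hηc
  have hE' : conj E ≠ 0 := (map_ne_zero _).2 hE
  constructor
  · rintro ⟨h1, h2⟩
    have h1c := congrArg conj h1
    simp only [map_add, map_mul, Complex.conj_conj, map_zero, hsc, hcc, hTc] at h1c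
    have h3 : E * T * (p * s + c * conj n) + conj u * conj E * c = 0 := by
      field_simp at h1c
      linear_combination h1c
    -- Inverting the rotation: this combination eliminates the potential, and the one in `hu`
    -- eliminates `p`.
    have hp : p = -Complex.I * conj t * c ^ 2 := by
      have : E * T * (p + Complex.I * conj t * c ^ 2) = 0 := by
        linear_combination s * h3 - c * h2 - E * T * p * hcs
      have := (mul_eq_zero.1 this).resolve_left (mul_ne_zero hE hT)
      linear_combination this
    refine ⟨hp, ?_⟩
    have hu : conj u * conj E = -(E * T * (conj n - Complex.I * conj t * s * c)) := by
      linear_combination c * h3 + s * h2 - (conj u * conj E + E * T * conj n) * hcs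
    have huc := congrArg conj hu
    simp only [map_sub, map_mul, map_neg, Complex.conj_conj, Complex.conj_I, hsc, hcc, hTc] at huc
    field_simp at huc ⊢
    linear_combination huc
  · rintro ⟨rfl, rfl⟩
    simp only [map_add, map_mul, map_neg, map_pow, map_div₀, Complex.conj_conj, Complex.conj_I,
      hsc, hcc, hTc]
    constructor
    · field_simp
      ring
    · field_simp
      linear_combination E * T * Complex.I * conj t * c * hcs

end Spherical

/-! ### Assembly of the theorem -/

theorem mainTheorem1 {W : Set ℂ} {r : ℂ → EuclideanSpace ℝ (Fin 4)}
    (hr : IsConformalImmersionOn r W)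
    (Gψ Gφ : W → Projectivization ℂ (Fin 2 → ℂ)) (hG : AreGaussComponents hr Gψ Gφ) :
    -- the component `Gψ` in spherical coordinates
    (∀ θ η : ℂ → ℝ, ContDiffOn ℝ ∞ θ W → ContDiffOn ℝ ∞ η W →
      (∀ z : W, Gψ z = sphericalPoint (θ z) (η z)) →
      -- existence of a representative of `Gψ` satisfying the Dirac equation
      (∃ g : ℂ → ℂ, ContDiffOn ℝ ∞ g W ∧ SolvesDbar W θ η g ∧ Represents (liftOf θ η g) Gψ ∧
        ContDiffOn ℝ ∞ (potentialOf θ η g) W ∧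
        ∀ z ∈ W, dirac (potentialOf θ η g) (liftOf θ η g) z = 0) ∧
      -- the equation for `g` and the formula for the potential
      (∀ g U : ℂ → ℂ, ContDiffOn ℝ ∞ g W →
        ((∀ z ∈ W, dirac U (liftOf θ η g) z = 0) ↔
          SolvesDbar W θ η g ∧ Set.EqOn U (potentialOf θ η g) W)) ∧
      -- `g` is defined up to holomorphic functions `h`, and `U` up to the factors `e^{h̄ - h}`
      (∀ g g' : ℂ → ℂ, ContDiffOn ℝ ∞ g W → ContDiffOn ℝ ∞ g' W → SolvesDbar W θ η g →
        (SolvesDbar W θ η g' ↔ DifferentiableOn ℂ (fun z => g' z - g z) W)) ∧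
      (∀ g h : ℂ → ℂ, ∀ z ∈ W, potentialOf θ η (fun w => g w + h w) z =
        Complex.exp (conj (h z) - h z) * potentialOf θ η g z) ∧
      -- lifts with `ψ = (e^{g+iθ} cos η, e^{ḡ} sin η)` are related by gauge transformations
      (∀ (g g' : ℂ → ℂ) (φ φ' : ℂ → Fin 2 → ℂ) (U U' : ℂ → ℂ),
        ContDiffOn ℝ ∞ g W → ContDiffOn ℝ ∞ g' W →
        IsDiracLift r Gψ Gφ (liftOf θ η g) φ U → IsDiracLift r Gψ Gφ (liftOf θ η g') φ' U' →
        ∃ h : ℂ → ℂ, DifferentiableOn ℂ h W ∧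
          GaugeRelated W h (liftOf θ η g) φ U (liftOf θ η g') φ' U')) ∧
    -- `ψ` determines `φ`, which represents `Gφ` and satisfies the dual Dirac equation
    (∀ (ψ : ℂ → Fin 2 → ℂ) (U : ℂ → ℂ), ContDiffOn ℝ ∞ ψ W → Represents ψ Gψ →
      (∀ z ∈ W, dirac U ψ z = 0) →
      ∃ φ : ℂ → Fin 2 → ℂ, IsDiracLift r Gψ Gφ ψ φ U ∧
        ∀ φ' : ℂ → Fin 2 → ℂ, WeierstrassFormula r W ψ φ' → Set.EqOn φ' φ W) ∧
    -- gauge transformations with holomorphic `h` take lifts to lifts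
    (∀ (ψ φ : ℂ → Fin 2 → ℂ) (U h : ℂ → ℂ) (ψ' φ' : ℂ → Fin 2 → ℂ) (U' : ℂ → ℂ),
      IsDiracLift r Gψ Gφ ψ φ U → DifferentiableOn ℂ h W →
      GaugeRelated W h ψ φ U ψ' φ' U' → IsDiracLift r Gψ Gφ ψ' φ' U') ∧
    -- over a simply connected `W` any two lifts are related by such a transformation
    (IsSimplyConnected W →
      ∀ (ψ φ : ℂ → Fin 2 → ℂ) (U : ℂ → ℂ) (ψ' φ' : ℂ → Fin 2 → ℂ) (U' : ℂ → ℂ),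
        IsDiracLift r Gψ Gφ ψ φ U → IsDiracLift r Gψ Gφ ψ' φ' U' →
        ∃ h : ℂ → ℂ, DifferentiableOn ℂ h W ∧ GaugeRelated W h ψ φ U ψ' φ' U') := by
  have hW := hr.isOpen
  refine ⟨fun θ η hθ hη hsph => ?_, fun ψ U hψ hrep hD => ?_, fun ψ φ U h ψ' φ' U' hL hh hg =>
    hL.gauge hW hh hg, fun hsc ψ φ U ψ' φ' U' hL hL' => hL.exists_gaugeRelated hW hsc hL'⟩
  · have hθc : ContDiffOn ℝ ∞ (fun w => (θ w : ℂ)) W :=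
      Complex.ofRealCLM.contDiff.comp_contDiffOn hθ
    have hηc : ContDiffOn ℝ ∞ (fun w => (η w : ℂ)) W :=
      Complex.ofRealCLM.contDiff.comp_contDiffOn hη
    have hcos : ContDiffOn ℝ ∞ (fun w => (Real.cos (η w) : ℂ)) W :=
      Complex.ofRealCLM.contDiff.comp_contDiffOn hη.cos
    have hsin : ContDiffOn ℝ ∞ (fun w => (Real.sin (η w) : ℂ)) W :=
      Complex.ofRealCLM.contDiff.comp_contDiffOn hη.sin
    have hiff (g U : ℂ → ℂ) (hg : ContDiffOn ℝ ∞ g W) :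
        (∀ z ∈ W, dirac U (liftOf θ η g) z = 0) ↔
          SolvesDbar W θ η g ∧ Set.EqOn U (potentialOf θ η g) W := by
      have h : ∀ z ∈ W, _ := fun z hz => dirac_liftOf_eq_zero_iff (U := U)
        (hθc.differentiableAt_of_isOpen hW hz) (hηc.differentiableAt_of_isOpen hW hz)
        (hg.differentiableAt_of_isOpen hW hz)
      exact ⟨fun hD => ⟨fun z hz => ((h z hz).1 (hD z hz)).1, fun z hz => ((h z hz).1 (hD z hz)).2⟩,
        fun hs z hz => (h z hz).2 ⟨hs.1 z hz, hs.2 hz⟩⟩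
    refine ⟨?_, hiff, fun g g' hg hg' hs => ?_, fun g h z _ => potentialOf_add θ η g h z,
      fun g g' φ φ' U U' hg hg' hL hL' => ⟨fun z => g' z - g z,
        hL.gaugeRelated hW hL' (hg'.sub hg) fun z _ => liftOf_eq_gaugeVec θ η g g' z⟩⟩
    · obtain ⟨g, hg, hgs⟩ := hW.exists_dzbar_eq
        ((contDiffOn_const (c := -Complex.I)).mul (contDiffOn_dzbar hW hθc) |>.mul (hcos.pow 2))
      refine ⟨g, hg, hgs, represents_liftOf hsph g, ?_,
        (hiff g _ hg).2 ⟨hgs, Set.eqOn_refl _ _⟩⟩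
      exact ((((contDiffOn_conj hg).sub hg).sub (contDiffOn_const.mul hθc)).cexp.neg).mul
        ((((contDiffOn_const.mul (contDiffOn_dz hW hθc)).mul hsin).mul hcos).add
          (contDiffOn_dz hW hηc))
    · have hd {z : ℂ} (hz : z ∈ W) := hg.differentiableAt_of_isOpen hW hz
      have hd' {z : ℂ} (hz : z ∈ W) := hg'.differentiableAt_of_isOpen hW hz
      constructor
      · intro hs' z hz
        refine (differentiableAt_complex_iff_dzbar_eq_zero.2
          ⟨(hd' hz).fun_sub (hd hz), ?_⟩).differentiableWithinAt
        rw [dzbar_sub (hd' hz) (hd hz), hs z hz, hs' z hz, sub_self]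
      · intro hh z hz
        have := dzbar_eq_zero_of_differentiableOn hW hh hz
        rw [dzbar_sub (hd' hz) (hd hz), sub_eq_zero] at this
        rw [this, hs z hz]
  · obtain ⟨φ, hL⟩ := exists_isDiracLift hG hψ hrep hD
    exact ⟨φ, hL, fun φ' hw => WeierstrassFormula.eqOn hL.weierstrass hw fun z hz => (hrep ⟨z, hz⟩).1⟩
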